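/- Let $\mathbb N=\{1,2,\dots\}$, $\mathbb N_0=\mathbb N\cup\{0\}$. For $d,\ell\in\mathbb N$ with $d\ge 3\ell+1$, $u<v$ and $\theta=(\theta_1,\dots,\theta_d)\in\mathbb R^d$ let $\mathscr N_{u,v}^{\theta,(1,\ell,1)}\colon\mathbb R\to\mathbb R$ be the realization of the rectified clipped neural network with architecture $(1,\ell,1)$, i.e. $$\mathscr N_{u,v}^{\theta,(1,\ell,1)}(x)=\max\Bigl\{\min\Bigl\{\theta_{3\ell+1}+\sum_{i=1}^{\ell}\theta_{2\ell+i}\max\{\theta_i x+\theta_{\ell+i},0\},\,v\Bigr\},\,u\Bigr\}.$$ **Corollary.** Let $d,M,K,N\in\mathbb N$, $p\in(0,\infty)$, $L\in[0,\infty)$, $a,u\in\mathbb R$, $v\in(u,\infty)$, $b\in(a,\infty)$, $c\in[\max\{1,2|u|,2|v|,|a|,|b|,2L\},\infty)$, $\beta\in[c,\infty)$, let $\ell\in\mathbb N$ satisfy $3\le\ell\le(d-1)/3$, and let $\mathfrak N\subseteq\{0,1,\dots,N\}$ satisfy $0\in\mathfrak N$. Let $(\Omega,\mathcal F,\mathbb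 P)$ be a probability space, let $(X_j,Y_j)\colon\Omega\to[a,b]\times[u,v]$, $j\in\{1,\dots,M\}$, be i.i.d. random variables, and let $\mathcal E\colon[a,b]\to[u,v]$ satisfy $\mathcal E(X_1)=\mathbb E[Y_1\mid X_1]$ $\mathbb P$-a.s. and $|\mathcal E(x)-\mathcal E(y)|\le L|x-y|$ for all $x,y\in[a,b]$. Let $\Theta_{k,n}\colon\Omega\to\mathbb R^d$, $k,n\in\mathbb N_0$, and $\mathbf k\colon\Omega\to(\mathbb N_0)^2$ be random variables, assume that $\Theta_{k,0}$, $k\in\{1,\dots,K\}$, are i.i.d. and that $\Theta_{1,0}$ is continuous uniformly distributed on $[-c,c]^d$. For $\theta\in\mathbb R^d$, $\omega\in\Omega$ let $$\mathcal R(\theta,\omega)=\frac1M\sum_{j=1}^M\bigl|\mathscr N_{u,v}^{\theta,(1,\ell,1)}(X_j(\omega))-Y_j(\omega)\bigr|^2,$$ and assume for all $\omega\in\Omega$ that $$\mathbf k(\omega)\in\operatorname*{arg\,min}_{(k,n)\in\{1,\dots,K\}\times\mathfrak N,\ \|\Theta_{k,n}(\omega)\|_\infty\le\beta}\mathcal R(\Theta_{k,n}(\omega),\omega).$$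 Then the integral and the expectation below are well defined and finite (in particular, the inner integral is a measurable function of $\omega$), and $$\begin{aligned} &\Bigl(\mathbb E\Bigl[\Bigl(\int_{[a,b]}\bigl|\mathscr N_{u,v}^{\Theta_{\mathbf k},(1,\ell,1)}(x)-\mathcal E(x)\bigr|^2\,\mathbb P_{X_1}(\mathrm dx)\Bigr)^{p/2}\Bigr]\Bigr)^{1/p}\\ &\le\frac{L(b-a)}{\ell-2}+\frac{\bigl[8(v-u)(\ell+1)^2c^3\max\{p/2,1\}\bigr]^{1/2}}{K^{(\ell+1)^{-2}/4}}+\frac{\max\{v-u,1\}\bigl[20(\ell+1)^{3/2}\max\{p/2,\ln(4M\beta c)\}\bigr]^{1/2}}{M^{1/4}}\\ &\le\frac{3c^2}{\ell}+\frac{4c^2\ell\max\{p,1\}}{K^{(\ell+1)^{-2}/4}}+\frac{6\beta c\,\ell\max\{p,\ln(eM)\}}{M^{1/4}}. \end{aligned}$$ -/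

import Mathlib

open MeasureTheory ProbabilityTheory

noncomputable section

/-- The entry of `θ ∈ ℝ^d` with zero-based index `i` (zero if `i` is out of range). -/
def paramEntry {d : ℕ} (θ : Fin d → ℝ) (i : ℕ) : ℝ :=
  if h : i < d then θ ⟨i, h⟩ else 0

/-- The affine map `ℝ^n → ℝ^m` read off from the entries of `θ` after the first `s` ones:
first the `m × n` weight matrix, row by row, then the `m` biases. -/
def affineLayer {d : ℕ} (θ : Fin d → ℝ) (s m n : ℕ) (x : Fin n → ℝ) : Fin m → ℝ :=
  fun i => (∑ j : Fin n, paramEntry θ (s + i * n + j) * x j) + paramEntry θ (s + m * n + i)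

/-- The rectifier function. -/
def rectifier (x : ℝ) : ℝ := max x 0

/-- The clipping function. -/
def clipping (u v x : ℝ) : ℝ := max (min x v) u

/-- Number of parameters in the first `k` layers of a network with layer dimensions
`l 0, l 1, l 2, …`. -/
def numParams (l : ℕ → ℕ) (k : ℕ) : ℕ := ∑ i ∈ Finset.range k, l (i + 1) * (l i + 1)

/-- Output of the `k`-th rectified hidden layer (the input itself for `k = 0`). -/
def hiddenLayer {d : ℕ} (θ : Fin d → ℝ) (l : ℕ → ℕ) :
    (k : ℕ) → (Fin (l 0) → ℝ) → (Fin (l k) → ℝ)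
  | 0, x => x
  | k + 1, x => fun i =>
      rectifier (affineLayer θ (numParams l k) (l (k + 1)) (l k) (hiddenLayer θ l k x) i)

/-- The rectified clipped network with `H` hidden layers and
architecture `(l 0, l 1, …, l (H + 1))`: rectifiers on the hidden layers and the clipping function
on the output layer. -/
def clippedDNN {d : ℕ} (u v : ℝ) (θ : Fin d → ℝ) (l : ℕ → ℕ) (H : ℕ) (x : Fin (l 0) → ℝ) :
    Fin (l (H + 1)) → ℝ :=
  fun i => clipping u v
    (affineLayer θ (numParams l H) (l (H + 1)) (l H) (hiddenLayer θ l H x) i)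

/-- The architecture `(1, ℓ, 1)`. -/
def shallowArch (ℓ : ℕ) : ℕ → ℕ
  | 0 => 1
  | 1 => ℓ
  | _ => 1

/-- The rectified clipped network with architecture `(1, ℓ, 1)`, as a function `ℝ → ℝ`. -/
def shallowNet {d : ℕ} (u v : ℝ) (θ : Fin d → ℝ) (ℓ : ℕ) (x : ℝ) : ℝ :=
  clippedDNN u v θ (shallowArch ℓ) 1 (fun _ => x) ⟨0, Nat.one_pos⟩

/-- The squared `L²`-distance over `[a, b]` between `f` and `g` with respect to `ν`. -/
def sqL2Error (ν : Measure ℝ) (a b : ℝ) (f g : ℝ → ℝ) : ℝ :=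
  ∫ x in Set.Icc a b, |f x - g x| ^ 2 ∂ν

end

/-! Since `E (X₀)` is the conditional expectation of `Y₀`, the squared L² distance of a network to
`E` is its risk minus the risk of `E`. Comparing the selected network with a reference parameter
`w₀` splits this excess risk into three parts.

Approximation: interpolating the Lipschitz target at equidistant knots gives a `w₀` with entries in
`[-c, c]` and uniform error at most `L (b - a) / ℓ` (`exists_shallowSum_approx`).

Optimization: the selected network has empirical risk no larger than the initialization closest to
`w₀`, and risks are Lipschitz in the parameters. With `D` the smallest distance of `K` independent
uniform initializations to `w₀`, the variable `K (D / 2c) ^ (3ℓ + 1)` has the tail `exp (-y)`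
(`measure_bestDist_pow_gt_le`), so `D` is of order `K ^ (-1 / (3ℓ + 1))`.

Generalization: Hoeffding's inequality and a union bound over a finite grid in `[-β, β] ^ (3ℓ + 1)`,
extended by Lipschitz continuity, bound empirical minus true risk uniformly by the square root of a
variable with exponential tail, divided by `√M` (`exists_tail_abs_empRisk_sub_trueRisk_le`).

Together these give an almost sure bound `F ≤ A² + C₁ Z ^ ρ + (C₂ √W + C₃)` on the squared error.
Square roots are subadditive, Minkowski's inequality in `L^(4n)` with `p ≤ 4n` separates the terms,
and an exponential tail gives an `L^n` norm of at most `n`. The rest is elementary estimation of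
constants. -/

/-! ### Shallow networks and their dependence on the parameters -/

/-- The unclipped realization of a shallow rectified network with `ℓ` hidden neurons and
parameter sequence `w`. -/
def shallowSum (ℓ : ℕ) (w : ℕ → ℝ) (x : ℝ) : ℝ :=
  w (3 * ℓ) + ∑ i ∈ Finset.range ℓ, w (2 * ℓ + i) * max (w i * x + w (ℓ + i)) 0

/-- Parameters become sequences on `ℕ`, so that interpolants and grid points are treated like `θ`
without reference to `d`, which may exceed `3ℓ + 1`. -/
theorem shallowNet_eq {d : ℕ} (u v : ℝ) (θ : Fin d → ℝ) (ℓ : ℕ) (x : ℝ) :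
    shallowNet u v θ ℓ x = clipping u v (shallowSum ℓ (paramEntry θ) x) := by
  simp only [shallowNet, clippedDNN, affineLayer, hiddenLayer, numParams, shallowArch, shallowSum,
    rectifier]
  congr 1
  rw [Finset.sum_range (n := ℓ), add_comm]
  congr 1
  · congr 1
    simp
    ring
  · have h : numParams (shallowArch ℓ) 1 = 2 * ℓ := by
      simp [numParams, shallowArch]; ring
    refine Finset.sum_congr rfl fun i _ => ?_
    congr 1
    · congr 1
      simp
      ring
    · have hs : ∀ f : Fin 1 → ℝ, ∑ j, f j = f 0 := by simp
      refine congrArg (max · 0) (congrArg₂ (· + ·) ((hs _).trans ?_) ?_)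
      · simp
      · simp

theorem clipping_mem {u v : ℝ} (huv : u ≤ v) (x : ℝ) : clipping u v x ∈ Set.Icc u v :=
  ⟨le_max_right _ _, max_le (min_le_right _ _) huv⟩

theorem clipping_of_mem {u v x : ℝ} (hx : x ∈ Set.Icc u v) : clipping u v x = x := by
  rw [clipping, min_eq_left hx.2, max_eq_left hx.1]

theorem abs_clipping_sub_le (u v x y : ℝ) : |clipping u v x - clipping u v y| ≤ |x - y| :=
  (abs_max_sub_max_le_abs _ _ _).trans ((abs_min_sub_min_le_max x v y v).trans (by simp))

theorem continuous_clipping (u v : ℝ) : Continuous (clipping u v) := by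
  unfold clipping; fun_prop

/-- Changing the outer weight and then the inner parameters of one neuron costs `δ (Bc + B) + B (δc
+ δ) ≤ 4Bcδ`, by `1 ≤ c`; the output bias costs another `δ`. -/
theorem abs_shallowSum_sub_le {ℓ : ℕ} {w w' : ℕ → ℝ} {B c δ x : ℝ} (hc : 1 ≤ c)
    (hw : ∀ i < 3 * ℓ + 1, |w i| ≤ B) (hw' : ∀ i < 3 * ℓ + 1, |w' i| ≤ B)
    (hδ : ∀ i < 3 * ℓ + 1, |w i - w' i| ≤ δ) (hx : |x| ≤ c) :
    |shallowSum ℓ w x - shallowSum ℓ w' x| ≤ (1 + 4 * ℓ * B * c) * δ := by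
  have hB0 : 0 ≤ B := (abs_nonneg _).trans (hw 0 (by omega))
  have hδ0 : 0 ≤ δ := (abs_nonneg _).trans (hδ 0 (by omega))
  have key : ∀ i ∈ Finset.range ℓ, |w (2 * ℓ + i) * max (w i * x + w (ℓ + i)) 0
      - w' (2 * ℓ + i) * max (w' i * x + w' (ℓ + i)) 0| ≤ 4 * B * c * δ := by
    intro i hi
    have hi := Finset.mem_range.1 hi
    have e : w (2 * ℓ + i) * max (w i * x + w (ℓ + i)) 0
      - w' (2 * ℓ + i) * max (w' i * x + w' (ℓ + i)) 0
      = (w (2 * ℓ + i) - w' (2 * ℓ + i)) * max (w i * x + w (ℓ + i)) 0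
        + w' (2 * ℓ + i) * (max (w i * x + w (ℓ + i)) 0 - max (w' i * x + w' (ℓ + i)) 0) := by ring
    have h1 : |max (w i * x + w (ℓ + i)) 0| ≤ B * c + B := by
      have : |max (w i * x + w (ℓ + i)) 0| ≤ |w i * x + w (ℓ + i)| := by
        rw [abs_of_nonneg (le_max_right _ _)]
        exact max_le (le_abs_self _) (abs_nonneg _)
      refine this.trans ((abs_add_le _ _).trans ?_)
      rw [abs_mul]
      gcongr
      · exact hw _ (by omega)
      · exact hw _ (by omega)
    have h2 : |max (w i * x + w (ℓ + i)) 0 - max (w' i * x + w' (ℓ + i)) 0| ≤ δ * c + δ := by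
      refine (abs_max_sub_max_le_abs _ _ _).trans ?_
      have : w i * x + w (ℓ + i) - (w' i * x + w' (ℓ + i))
        = (w i - w' i) * x + (w (ℓ + i) - w' (ℓ + i)) := by ring
      rw [this]
      refine (abs_add_le _ _).trans ?_
      rw [abs_mul]
      gcongr
      · exact hδ _ (by omega)
      · exact hδ _ (by omega)
    rw [e]
    refine (abs_add_le _ _).trans ?_
    rw [abs_mul, abs_mul]
    calc _ ≤ δ * (B * c + B) + B * (δ * c + δ) := by
          gcongr
          · exact hδ _ (by omega)
          · exact hw' _ (by omega)
      _ = 2 * (B * δ) * (c + 1) := by ring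
      _ ≤ 2 * (B * δ) * (c + c) := by gcongr
      _ = _ := by ring
  have e : shallowSum ℓ w x - shallowSum ℓ w' x = (w (3 * ℓ) - w' (3 * ℓ)) +
      ∑ i ∈ Finset.range ℓ, (w (2 * ℓ + i) * max (w i * x + w (ℓ + i)) 0
      - w' (2 * ℓ + i) * max (w' i * x + w' (ℓ + i)) 0) := by
    rw [Finset.sum_sub_distrib]; unfold shallowSum; ring
  rw [e]
  refine (abs_add_le _ _).trans ?_
  have h3 := (Finset.abs_sum_le_sum_abs _ _).trans (Finset.sum_le_sum key)
  rw [Finset.sum_const, Finset.card_range, nsmul_eq_mul] at h3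
  have h4 := hδ (3 * ℓ) (by omega)
  linarith

theorem abs_paramEntry_le {d : ℕ} (θ : Fin d → ℝ) (i : ℕ) : |paramEntry θ i| ≤ ‖θ‖ := by
  unfold paramEntry
  split
  · exact norm_le_pi_norm θ _
  · simp

theorem continuous_paramEntry {d : ℕ} (i : ℕ) :
    Continuous (fun θ : Fin d → ℝ => paramEntry θ i) := by
  unfold paramEntry
  split <;> fun_prop

theorem continuous_shallowNet {d : ℕ} (u v : ℝ) (ℓ : ℕ) :
    Continuous (fun q : (Fin d → ℝ) × ℝ => shallowNet u v q.1 ℓ q.2) := by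
  simp only [shallowNet_eq]
  refine (continuous_clipping u v).comp ?_
  unfold shallowSum
  have := fun i => (continuous_paramEntry (d := d) i).comp (continuous_fst (Y := ℝ))
  simp only [Function.comp_def] at this
  fun_prop

theorem continuous_shallowSum (ℓ : ℕ) (w : ℕ → ℝ) : Continuous (shallowSum ℓ w) := by
  unfold shallowSum; fun_prop

/-! ### Approximation by piecewise linear interpolation -/

/-- Piecewise linear interpolation of a Lipschitz function by a shallow network with bounded
parameters. -/
theorem exists_shallowSum_approx {a b c L : ℝ} (hab : a < b) (hL : 0 ≤ L) {E : ℝ → ℝ}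
    (hE : ∀ x y, |E x - E y| ≤ L * |x - y|) {ℓ : ℕ} (hℓ : 0 < ℓ) (hc : 1 ≤ c)
    (hca : |a| ≤ c) (hcb : |b| ≤ c) (hcL : 2 * L ≤ c) (hcE : |E a| ≤ c) :
    ∃ w : ℕ → ℝ, (∀ i, |w i| ≤ c) ∧
      ∀ x ∈ Set.Icc a b, |shallowSum ℓ w x - E x| ≤ L * (b - a) / ℓ := by
  have hℓ' : (0 : ℝ) < ℓ := by exact_mod_cast hℓ
  set h : ℝ := (b - a) / ℓ with hh
  have hpos : 0 < h := div_pos (by linarith) hℓ'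
  have hℓh : ℓ * h = b - a := by rw [hh]; field_simp
  set X : ℕ → ℝ := fun k => a + k * h with hX
  set s : ℕ → ℝ := fun k => (E (X (k + 1)) - E (X k)) / h with hs
  have hXs : ∀ k, X (k + 1) = X k + h := fun k => by simp only [hX]; push_cast; ring
  have hsL : ∀ k, |s k| ≤ L := by
    intro k
    rw [hs]
    simp only [abs_div, abs_of_pos hpos]
    rw [div_le_iff₀ hpos]
    refine (hE _ _).trans_eq ?_
    rw [hXs, add_sub_cancel_left, abs_of_pos hpos]
  -- Slope jumps at the knots; they are at most `2L` in absolute value, which is why `2L ≤ c` is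
  -- required.
  set t : ℕ → ℝ := fun k => if k = 0 then s 0 else s k - s (k - 1) with ht
  have htc : ∀ k, |t k| ≤ c := by
    intro k
    rw [ht]
    dsimp only
    split
    · linarith [hsL 0]
    · have := abs_sub (s k) (s (k - 1))
      linarith [hsL k, hsL (k - 1)]
  -- values of the interpolant
  have hval : ∀ k, ∀ x, X k ≤ x → E a + ∑ i ∈ Finset.range (k + 1), t i * (x - X i)
      = E (X k) + s k * (x - X k) := by
    intro k x _
    induction k with
    | zero => simp [ht, hX]
    | succ k ih =>
      rename_i hx
      rw [Finset.sum_range_succ, ← add_assoc, ih (by rw [hXs] at hx; linarith)]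
      have h1 : t (k + 1) = s (k + 1) - s k := by simp [ht]
      have h2 : E (X (k + 1)) = E (X k) + s k * h := by
        simp only [hs]; field_simp; ring
      rw [h1, h2, hXs]; ring
  -- Neuron `i` is the hinge `max (x - X i) 0`: inner weight 1, bias `-X i`, outer weight `t i`. The
  -- output bias is `E a`.
  refine ⟨fun i => if i < ℓ then 1 else if i < 2 * ℓ then - X (i - ℓ) else
    if i < 3 * ℓ then t (i - 2 * ℓ) else E a, ?_, ?_⟩
  · intro i
    dsimp only
    split_ifs with h1 h2 h3
    · simpa using hc
    · rw [abs_neg, abs_le]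
      have hi : ((i - ℓ : ℕ) : ℝ) ≤ ℓ := by exact_mod_cast (by omega)
      have h5 : ((i - ℓ : ℕ) : ℝ) * h ≤ b - a := by rw [← hℓh]; gcongr
      have h6 : 0 ≤ ((i - ℓ : ℕ) : ℝ) * h := by positivity
      simp only [hX]
      rw [abs_le] at hca hcb
      constructor <;> linarith
    · exact htc _
    · exact hcE
  · intro x hx
    have hsum : shallowSum ℓ (fun i => if i < ℓ then 1 else if i < 2 * ℓ then - X (i - ℓ) else
        if i < 3 * ℓ then t (i - 2 * ℓ) else E a) x
        = E a + ∑ i ∈ Finset.range ℓ, t i * max (x - X i) 0 := by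
      unfold shallowSum
      congr 1
      · simp [show ¬ 3 * ℓ < ℓ by omega, show ¬ 3 * ℓ < 2 * ℓ by omega]
      · refine Finset.sum_congr rfl fun i hi => ?_
        have hi := Finset.mem_range.1 hi
        simp [show ¬ 2 * ℓ + i < ℓ by omega, show ¬ ℓ + i < ℓ by omega, hi,
          show ℓ + i < 2 * ℓ by omega, show 2 * ℓ + i < 3 * ℓ by omega, sub_eq_add_neg]
    rw [hsum]
    obtain ⟨k, hkℓ, hk1, hk2⟩ : ∃ k, k < ℓ ∧ X k ≤ x ∧ x ≤ X (k + 1) := by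
      -- At `x = b` the floor would give `k = ℓ`, one subinterval too far.
      by_cases hxb : x = b
      · refine ⟨ℓ - 1, by omega, ?_, ?_⟩
        · simp only [hX, hxb]; push_cast [Nat.cast_sub (show 1 ≤ ℓ by omega)]; linarith
        · have : ((ℓ - 1 + 1 : ℕ) : ℝ) = ℓ := by congr 1; omega
          simp only [hX, hxb, this]; linarith
      · have hxb : x < b := lt_of_le_of_ne hx.2 hxb
        have h0 : 0 ≤ (x - a) / h := div_nonneg (by linarith [hx.1]) hpos.le
        refine ⟨⌊(x - a) / h⌋₊, ?_, ?_, ?_⟩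
        · rw [Nat.floor_lt h0, div_lt_iff₀ hpos]; linarith
        · have := Nat.floor_le h0
          rw [le_div_iff₀ hpos] at this
          simp only [hX]; linarith
        · have := (Nat.lt_floor_add_one ((x - a) / h)).le
          rw [div_le_iff₀ hpos] at this
          simp only [hX]; push_cast; linarith
    -- Only hinges with knots up to `X k` are active at `x`; there the rectifier is the identity.
    have hsplit : ∑ i ∈ Finset.range ℓ, t i * max (x - X i) 0
        = ∑ i ∈ Finset.range (k + 1), t i * (x - X i) := by
      rw [← Finset.sum_subset (Finset.range_mono (show k + 1 ≤ ℓ by omega))]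
      · refine Finset.sum_congr rfl fun i hi => ?_
        rw [max_eq_left]
        have hi : (i : ℝ) ≤ k := by exact_mod_cast Nat.lt_succ_iff.1 (Finset.mem_range.1 hi)
        have : (i : ℝ) * h ≤ k * h := by gcongr
        simp only [hX] at hk1 ⊢
        linarith
      · intro i _ hi
        have hi : ((k + 1 : ℕ) : ℝ) ≤ i := by exact_mod_cast not_lt.1 (Finset.mem_range.not.1 hi)
        have : ((k + 1 : ℕ) : ℝ) * h ≤ i * h := by gcongr
        rw [max_eq_right, mul_zero]
        simp only [hX] at hk2 ⊢
        linarith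
    rw [hsplit, hval k x hk1]
    -- convex combination
    set r := (x - X k) / h with hr
    have hr0 : 0 ≤ r := div_nonneg (by linarith) hpos.le
    have hr1 : r ≤ 1 := by rw [hr, div_le_one hpos]; linarith [hXs k]
    have e : E (X k) + s k * (x - X k) - E x
        = (1 - r) * (E (X k) - E x) + r * (E (X (k + 1)) - E x) := by
      simp only [hs, hr]; field_simp; ring
    rw [e]
    have b1 : |E (X k) - E x| ≤ L * h := by
      refine (hE _ _).trans ?_
      gcongr
      rw [abs_sub_comm, abs_of_nonneg (by linarith)]; linarith [hXs k]
    have b2 : |E (X (k + 1)) - E x| ≤ L * h := by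
      refine (hE _ _).trans ?_
      gcongr
      rw [abs_of_nonneg (by linarith)]; linarith [hXs k]
    calc _ ≤ (1 - r) * |E (X k) - E x| + r * |E (X (k + 1)) - E x| := by
          refine (abs_add_le _ _).trans ?_
          rw [abs_mul, abs_mul, abs_of_nonneg hr0, abs_of_nonneg (by linarith : 0 ≤ 1 - r)]
      _ ≤ (1 - r) * (L * h) + r * (L * h) := by
          gcongr
      _ = L * (b - a) / ℓ := by rw [hh]; ring

/-! ### Moments from exponential tails -/

/-- By the layer cake formula the `n`-th moment is at most `n Γ(n) = n! ≤ n ^ n`. Integrality of `n`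
makes the Gamma value a factorial. -/
theorem eLpNorm_le_of_exp_tail {Ω : Type*} [MeasurableSpace Ω] {P : Measure Ω}
    {T : Ω → ℝ} (hT : Measurable T)
    (htail : ∀ y : ℝ, 0 < y → P {ω | y < T ω} ≤ ENNReal.ofReal (Real.exp (-y)))
    {n : ℕ} (hn : 1 ≤ n) :
    eLpNorm (fun ω => max (T ω) 0) n P ≤ n := by
  have hn0 : (0 : ℝ) < n := by exact_mod_cast hn
  have h1 := lintegral_rpow_eq_lintegral_meas_lt_mul P (f := fun ω => max (T ω) 0)
    (Filter.Eventually.of_forall fun ω => le_max_right _ _) (by fun_prop) hn0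
  have h2 : ∫⁻ ω, ENNReal.ofReal (max (T ω) 0 ^ (n : ℝ)) ∂P ≤ ENNReal.ofReal (n ^ n) := by
    rw [h1]
    calc _ ≤ ENNReal.ofReal n * ∫⁻ t in Set.Ioi 0,
            ENNReal.ofReal (Real.exp (-t) * t ^ ((n : ℝ) - 1)) := by
          refine mul_le_mul' le_rfl ?_
          refine setLIntegral_mono' (measurableSet_Ioi (a := (0 : ℝ))) fun t ht => ?_
          rw [ENNReal.ofReal_mul (Real.exp_pos _).le]
          gcongr
          refine (measure_mono fun ω hω => ?_).trans (htail t ht)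
          rcases lt_max_iff.1 (show t < max (T ω) 0 from hω) with h | h
          · exact h
          · exact absurd h (not_lt.2 (le_of_lt ht))
      _ = ENNReal.ofReal n * ENNReal.ofReal (Real.Gamma n) := by
          rw [Real.Gamma_eq_integral hn0,
            ofReal_integral_eq_lintegral_ofReal (Real.GammaIntegral_convergent hn0)]
          refine (ae_restrict_iff' (measurableSet_Ioi (a := (0 : ℝ)))).2 (Filter.Eventually.of_forall fun t ht => ?_)
          exact mul_nonneg (Real.exp_pos _).le (Real.rpow_nonneg (le_of_lt ht) _)
      _ = ENNReal.ofReal (n.factorial) := by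
          rw [← ENNReal.ofReal_mul hn0.le, ← Real.Gamma_add_one hn0.ne', Real.Gamma_nat_eq_factorial]
      _ ≤ _ := by
          apply ENNReal.ofReal_le_ofReal
          exact_mod_cast Nat.factorial_le_pow n
  rw [eLpNorm_eq_lintegral_rpow_enorm_toReal (by simpa using by omega) (by simp)]
  simp only [ENNReal.toReal_natCast]
  have h3 : ∀ ω, ‖max (T ω) 0‖ₑ ^ (n : ℝ) = ENNReal.ofReal (max (T ω) 0 ^ (n : ℝ)) := by
    intro ω
    rw [Real.enorm_of_nonneg (le_max_right _ _), ENNReal.ofReal_rpow_of_nonneg (le_max_right _ _) hn0.le]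
  simp only [h3]
  calc _ ≤ (ENNReal.ofReal (n ^ n)) ^ (1 / (n : ℝ)) := by gcongr
    _ = n := by
      rw [← Real.rpow_natCast, ENNReal.ofReal_rpow_of_nonneg (by positivity) (by positivity),
        ← Real.rpow_mul (by positivity), mul_one_div_cancel hn0.ne', Real.rpow_one]
      simp

/-- The `L^r` norm of `f ^ α` is the `α`-th power of the `L^(rα)` norm of `f`, and norms increase
with the exponent on a probability space. -/
theorem eLpNorm_rpow_le_of_eLpNorm_le {Ω : Type*} [MeasurableSpace Ω] {P : Measure Ω}
    [IsProbabilityMeasure P] {f : Ω → ℝ} (hf : Measurable f) (hf0 : ∀ ω, 0 ≤ f ω)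
    {α : ℝ} (hα : 0 < α) {r s : ENNReal} (hrs : r * ENNReal.ofReal α ≤ s) {B : ℝ} (hB : 0 ≤ B)
    (h : eLpNorm f s P ≤ ENNReal.ofReal B) :
    eLpNorm (fun ω => f ω ^ α) r P ≤ ENNReal.ofReal (B ^ α) := by
  have e : (fun ω => f ω ^ α) = fun ω => ‖f ω‖ ^ α := by
    ext ω; rw [Real.norm_of_nonneg (hf0 ω)]
  rw [e, eLpNorm_norm_rpow f hα, ← ENNReal.ofReal_rpow_of_nonneg hB hα.le]
  gcongr
  exact (eLpNorm_le_eLpNorm_of_exponent_le hrs hf.aestronglyMeasurable).trans h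

/-! ### Concentration of finitely many empirical means -/

/-- Two-sided Hoeffding inequality: values in `[0, D]` make the centred summands sub-Gaussian with
variance proxy `(D / 2) ^ 2`, and so are their negatives. -/
theorem measure_sum_sub_mean_ge_le {Ω : Type*} [MeasurableSpace Ω] {P : Measure Ω}
    [IsProbabilityMeasure P] {M : ℕ} {D m : ℝ} (hD : 0 < D)
    {f : Fin M → Ω → ℝ} (hf : ∀ j, Measurable (f j)) (hfD : ∀ j ω, f j ω ∈ Set.Icc 0 D)
    (hind : iIndepFun f P) (hm : ∀ j, ∫ ω, f j ω ∂P = m) {t : ℝ} (ht : 0 ≤ t) :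
    P.real {ω | t ≤ |∑ j, (f j ω - m)|} ≤ 2 * Real.exp (-(2 * t ^ 2 / (M * D ^ 2))) := by
  have hsub : ∀ j, HasSubgaussianMGF (fun ω => f j ω - m) ((‖D - 0‖₊ / 2) ^ 2) P := fun j => by
    have := hasSubgaussianMGF_of_mem_Icc (hf j).aemeasurable
      (Filter.Eventually.of_forall (hfD j) : ∀ᵐ ω ∂P, _)
    rwa [hm] at this
  have hind1 : iIndepFun (fun j ω => f j ω - m) P :=
    hind.comp (fun _ x => x - m) fun _ => by fun_prop
  have hind2 : iIndepFun (fun j => -(fun ω => f j ω - m)) P :=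
    hind.comp (fun _ x => -(x - m)) fun _ => by fun_prop
  have h1 := HasSubgaussianMGF.measure_sum_ge_le_of_iIndepFun hind1 (s := Finset.univ)
    (fun j _ => hsub j) ht
  have h2 := HasSubgaussianMGF.measure_sum_ge_le_of_iIndepFun hind2 (s := Finset.univ)
    (fun j _ => (hsub j).neg) ht
  have e : -t ^ 2 / (2 * ∑ i ∈ (Finset.univ : Finset (Fin M)),
      (((fun _ => (‖D - 0‖₊ / 2) ^ 2) i : NNReal) : ℝ)) = -(2 * t ^ 2 / (M * D ^ 2)) := by
    simp only [Finset.sum_const, Finset.card_univ, Fintype.card_fin, nsmul_eq_mul]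
    push_cast
    rw [sub_zero, Real.norm_of_nonneg hD.le]
    rcases Nat.eq_zero_or_pos M with h | h
    · simp [h]
    · field_simp
  push_cast at h1 h2 e
  rw [e] at h1 h2
  calc _ ≤ P.real ({ω | t ≤ ∑ j, (f j ω - m)} ∪
        {ω | t ≤ ∑ j, (-(fun ω => f j ω - m)) ω}) := by
        refine measureReal_mono fun ω hω => ?_
        rcases le_abs.1 (show t ≤ |∑ j, (f j ω - m)| from hω) with h | h
        · exact Or.inl h
        · refine Or.inr (h.trans_eq ?_)
          simp only [Pi.neg_apply, Finset.sum_neg_distrib]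
    _ ≤ _ := (measureReal_union_le _ _).trans (by linarith)

/-- Exponential tail of the maximal normalized squared deviation of finitely many empirical
means. -/
theorem measure_sup_sq_mean_sub_le {Ω : Type*} [MeasurableSpace Ω] {P : Measure Ω}
    [IsProbabilityMeasure P] {M : ℕ} (hM : 0 < M) {D : ℝ} (hD : 0 < D)
    {ι : Type*} [Fintype ι] [Nonempty ι] {f : ι → Fin M → Ω → ℝ} {m : ι → ℝ}
    (hf : ∀ i j, Measurable (f i j)) (hfD : ∀ i j ω, f i j ω ∈ Set.Icc 0 D)
    (hind : ∀ i, iIndepFun (f i) P) (hm : ∀ i j, ∫ ω, f i j ω ∂P = m i) {y : ℝ} (hy : 0 < y) :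
    P {ω | y < Finset.univ.sup' Finset.univ_nonempty
        (fun i => 2 * M / D ^ 2 * (1 / (M : ℝ) * ∑ j, f i j ω - m i) ^ 2)
        - Real.log (2 * Fintype.card ι)} ≤ ENNReal.ofReal (Real.exp (-y)) := by
  have hM' : (0 : ℝ) < M := by exact_mod_cast hM
  have hN : (1 : ℝ) ≤ Fintype.card ι := by exact_mod_cast Fintype.card_pos
  set z := y + Real.log (2 * Fintype.card ι) with hz
  have hz0 : 0 ≤ z := add_nonneg hy.le (Real.log_nonneg (by linarith))
  -- Chosen so that `2 t² / (M D²) = z`; each Hoeffding bound `2 exp (-z)` is then `exp (-y) / card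
  -- ι`, ready for the union bound.
  set t := D * M * √(z / (2 * M)) with ht
  have ht0 : 0 ≤ t := by positivity
  have ht2 : t ^ 2 = D ^ 2 * M * z / 2 := by
    rw [ht, mul_pow, Real.sq_sqrt (by positivity)]; field_simp
  have hsub : {ω | y < Finset.univ.sup' Finset.univ_nonempty
        (fun i => 2 * M / D ^ 2 * (1 / (M : ℝ) * ∑ j, f i j ω - m i) ^ 2)
        - Real.log (2 * Fintype.card ι)} ⊆ ⋃ i, {ω | t ≤ |∑ j, (f i j ω - m i)|} := by
    intro ω hω
    have hω : z < Finset.univ.sup' Finset.univ_nonempty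
        (fun i => 2 * M / D ^ 2 * (1 / (M : ℝ) * ∑ j, f i j ω - m i) ^ 2) := by
      have : y < _ - _ := hω
      linarith
    obtain ⟨i, -, hi⟩ := (Finset.lt_sup'_iff _).1 hω
    refine Set.mem_iUnion.2 ⟨i, ?_⟩
    refine (pow_le_pow_iff_left₀ ht0 (abs_nonneg _) two_ne_zero).1 ?_
    rw [sq_abs, ht2, Finset.sum_sub_distrib, Finset.sum_const, Finset.card_univ, Fintype.card_fin,
      nsmul_eq_mul]
    have e : (1 / (M : ℝ) * ∑ j, f i j ω - m i) ^ 2 = (∑ j, f i j ω - M * m i) ^ 2 / M ^ 2 := by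
      field_simp
    rw [e] at hi
    have e2 : (∑ j, f i j ω - M * m i) ^ 2
      = D ^ 2 * M / 2 * (2 * M / D ^ 2 * ((∑ j, f i j ω - M * m i) ^ 2 / M ^ 2)) := by
      field_simp
    rw [e2]
    calc D ^ 2 * M * z / 2 = D ^ 2 * M / 2 * z := by ring
      _ ≤ _ := by gcongr
  refine (measure_mono hsub).trans ((measure_iUnion_fintype_le _ _).trans ?_)
  have hi : ∀ i, P {ω | t ≤ |∑ j, (f i j ω - m i)|}
      ≤ ENNReal.ofReal (Real.exp (-y) / Fintype.card ι) := by
    intro i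
    have h := measure_sum_sub_mean_ge_le hD (hf i) (hfD i) (hind i) (hm i) ht0
    rw [← ofReal_measureReal]
    refine ENNReal.ofReal_le_ofReal (h.trans_eq ?_)
    have : 2 * t ^ 2 / (M * D ^ 2) = z := by rw [ht2]; field_simp
    rw [this, hz, neg_add, Real.exp_add, Real.exp_neg (Real.log _), Real.exp_log (by linarith)]
    field_simp
  refine (Finset.sum_le_sum fun i _ => hi i).trans_eq ?_
  rw [Finset.sum_const, Finset.card_univ, nsmul_eq_mul, ← ENNReal.ofReal_natCast,
    ← ENNReal.ofReal_mul (by positivity)]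
  congr 1
  field_simp

/-- Simultaneous deviation of finitely many empirical means, controlled by a random variable with
exponential tail. -/
theorem exists_tail_abs_mean_sub_le {Ω : Type*} [MeasurableSpace Ω] {P : Measure Ω}
    [IsProbabilityMeasure P] {M : ℕ} (hM : 0 < M) {D : ℝ} (hD : 0 < D)
    {ι : Type*} [Fintype ι] [Nonempty ι] {f : ι → Fin M → Ω → ℝ} {m : ι → ℝ}
    (hf : ∀ i j, Measurable (f i j)) (hfD : ∀ i j ω, f i j ω ∈ Set.Icc 0 D)
    (hind : ∀ i, iIndepFun (f i) P) (hm : ∀ i j, ∫ ω, f i j ω ∂P = m i) :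
    ∃ T : Ω → ℝ, Measurable T ∧
      (∀ y : ℝ, 0 < y → P {ω | y < T ω} ≤ ENNReal.ofReal (Real.exp (-y))) ∧
      ∀ ω i, |1 / (M : ℝ) * ∑ j, f i j ω - m i|
        ≤ D * √((max (T ω) 0 + Real.log (2 * Fintype.card ι)) / (2 * M)) := by
  have hM' : (0 : ℝ) < M := by exact_mod_cast hM
  refine ⟨fun ω => Finset.univ.sup' Finset.univ_nonempty
        (fun i => 2 * M / D ^ 2 * (1 / (M : ℝ) * ∑ j, f i j ω - m i) ^ 2)
        - Real.log (2 * Fintype.card ι), ?_,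
    fun y hy => measure_sup_sq_mean_sub_le hM hD hf hfD hind hm hy, fun ω i => ?_⟩
  · have : Measurable (Finset.univ.sup' Finset.univ_nonempty (fun i ω =>
        2 * M / D ^ 2 * (1 / (M : ℝ) * ∑ j, f i j ω - m i) ^ 2)) :=
      Finset.measurable_sup' _ fun i _ => by fun_prop
    convert this.sub_const (Real.log (2 * Fintype.card ι)) using 2
    simp [Finset.sup'_apply]
  · have h3 := Finset.le_sup' (fun i => 2 * M / D ^ 2 * (1 / (M : ℝ) * ∑ j, f i j ω - m i) ^ 2)
      (Finset.mem_univ i)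
    set S := Finset.univ.sup' Finset.univ_nonempty
      (fun i => 2 * M / D ^ 2 * (1 / (M : ℝ) * ∑ j, f i j ω - m i) ^ 2)
    dsimp only at h3 ⊢
    set z := 1 / (M : ℝ) * ∑ j, f i j ω - m i
    have e : ∀ y, D * √y = √(D ^ 2 * y) := fun y => by
      rw [Real.sqrt_mul (sq_nonneg D), Real.sqrt_sq hD.le]
    rw [e, ← Real.sqrt_sq_eq_abs]
    refine Real.sqrt_le_sqrt ?_
    have h5 := le_max_left (S - Real.log (2 * Fintype.card ι)) 0
    rw [div_mul_eq_mul_div, div_le_iff₀ (by positivity)] at h3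
    rw [mul_div_assoc', le_div_iff₀ (by positivity)]
    have h6 : S * D ^ 2 ≤ (max (S - Real.log (2 * Fintype.card ι)) 0
      + Real.log (2 * Fintype.card ι)) * D ^ 2 := by
      gcongr; linarith
    linarith

/-! ### Random initializations close to a target parameter -/

theorem paramEntry_of_lt {d : ℕ} (θ : Fin d → ℝ) {i : ℕ} (h : i < d) :
    paramEntry θ i = θ ⟨i, h⟩ := dif_pos h

/-- A random vector that is uniform on a cube is close to a given point of the cube, in its first
`k` coordinates, with probability bounded below. -/
theorem le_measure_paramEntry_sub_le {Ω : Type*} [MeasurableSpace Ω] {P : Measure Ω}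
    {d k : ℕ} (hk : k ≤ d) {c : ℝ} (hc : 0 < c) {Θ : Ω → (Fin d → ℝ)}
    (hunif : pdf.IsUniform Θ (Set.Icc (fun _ => -c) (fun _ => c)) P volume)
    {w : ℕ → ℝ} (hw : ∀ i, |w i| ≤ c) {t : ℝ} (ht0 : 0 ≤ t) (ht1 : t ≤ 1) :
    ENNReal.ofReal (t ^ k) ≤ P (Θ ⁻¹' {θ | ∀ i < k, |paramEntry θ i - w i| ≤ 2 * c * t}) := by
  have hvol : (volume : Measure (Fin d → ℝ)) (Set.Icc (fun _ => -c) (fun _ => c))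
      = ENNReal.ofReal ((2 * c) ^ d) := by
    rw [Real.volume_Icc_pi]
    simp only [Finset.prod_const, Finset.card_univ, Fintype.card_fin]
    rw [← ENNReal.ofReal_pow (by linarith)]
    congr 2; ring
  have hmeas : MeasurableSet {θ : Fin d → ℝ | ∀ i < k, |paramEntry θ i - w i| ≤ 2 * c * t} := by
    simp only [Set.ofPred_forall]
    refine MeasurableSet.iInter fun i => MeasurableSet.iInter fun _ => ?_
    exact measurableSet_le (((continuous_paramEntry i).sub continuous_const).abs).measurable
      measurable_const
  rw [hunif.measure_preimage (by rw [hvol]; simpa using by positivity) (by rw [hvol]; simp) hmeas,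
    hvol]
  -- Cutting the interval of radius `2ct` about `w i` down to `[-c, c]` leaves length at least
  -- `2ct`, even when `w i` is an endpoint. Each of the `k` coordinates thus contributes a factor of
  -- at least `t`.
  set lo : Fin d → ℝ := fun i => if (i : ℕ) < k then max (-c) (w i - 2 * c * t) else -c with hlo
  set hi : Fin d → ℝ := fun i => if (i : ℕ) < k then min c (w i + 2 * c * t) else c with hhi
  have hct : 0 ≤ 2 * c * t := by positivity
  have hct' : 2 * c * t ≤ 2 * c := by nlinarith
  have hbox : Set.Icc lo hi ⊆ Set.Icc (fun _ => -c) (fun _ => c) ∩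
      {θ : Fin d → ℝ | ∀ i < k, |paramEntry θ i - w i| ≤ 2 * c * t} := by
    intro θ hθ
    refine ⟨⟨fun i => ?_, fun i => ?_⟩, fun i hik => ?_⟩
    · refine le_trans ?_ (hθ.1 i)
      simp only [hlo]; split_ifs
      · exact le_max_left _ _
      · exact le_rfl
    · refine (hθ.2 i).trans ?_
      simp only [hhi]; split_ifs
      · exact min_le_left _ _
      · exact le_rfl
    · have h1 := hθ.1 ⟨i, by omega⟩
      have h2 := hθ.2 ⟨i, by omega⟩
      simp only [hlo, hhi, hik, if_true, max_le_iff, le_min_iff] at h1 h2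
      rw [paramEntry_of_lt θ (by omega), abs_le]
      constructor <;> linarith
  have hprod : ENNReal.ofReal ((2 * c) ^ d * t ^ k) ≤ volume (Set.Icc lo hi) := by
    rw [Real.volume_Icc_pi]
    have e : (2 * c) ^ d * t ^ k = ∏ i : Fin d, (2 * c * if (i : ℕ) < k then t else 1) := by
      rw [Finset.prod_mul_distrib, Finset.prod_const, Finset.card_univ, Fintype.card_fin,
        Finset.prod_ite, Finset.prod_const_one, mul_one, Finset.prod_const]
      congr 2
      rw [Fin.card_filter_val_lt, min_eq_right hk]
    rw [e, ENNReal.ofReal_prod_of_nonneg (fun i _ => by split_ifs <;> positivity)]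
    refine Finset.prod_le_prod' fun i _ => ENNReal.ofReal_le_ofReal ?_
    have hwi := abs_le.1 (hw i)
    simp only [hlo, hhi]
    split_ifs
    · rcases max_cases (-c) (w i - 2 * c * t) with h1 | h1 <;>
      rcases min_cases c (w i + 2 * c * t) with h2 | h2 <;> linarith
    · linarith
  rw [ENNReal.le_div_iff_mul_le (by left; simpa using by positivity) (by simp),
    ← ENNReal.ofReal_mul (by positivity), mul_comm]
  exact hprod.trans (measure_mono hbox)

/-- Distance between the first `n + 1` entries of two parameter sequences. -/
noncomputable def paramDist (n : ℕ) (w w' : ℕ → ℝ) : ℝ :=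
  (Finset.range (n + 1)).sup' Finset.nonempty_range_add_one fun i => |w i - w' i|

theorem abs_sub_le_paramDist {n i : ℕ} (hi : i < n + 1) (w w' : ℕ → ℝ) :
    |w i - w' i| ≤ paramDist n w w' :=
  Finset.le_sup' (fun i => |w i - w' i|) (Finset.mem_range.2 hi)

theorem paramDist_le_iff {n : ℕ} {w w' : ℕ → ℝ} {r : ℝ} :
    paramDist n w w' ≤ r ↔ ∀ i < n + 1, |w i - w' i| ≤ r := by
  simp [paramDist, Finset.sup'_le_iff]

theorem paramDist_nonneg (n : ℕ) (w w' : ℕ → ℝ) : 0 ≤ paramDist n w w' :=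
  (abs_nonneg _).trans (abs_sub_le_paramDist (Nat.succ_pos n) w w')

theorem measurable_paramDist {Ω : Type*} [MeasurableSpace Ω] {d n : ℕ} {Θ : Ω → (Fin d → ℝ)}
    (hΘ : Measurable Θ) (w : ℕ → ℝ) : Measurable fun ω => paramDist n (paramEntry (Θ ω)) w := by
  have := Finset.measurable_sup' (Finset.nonempty_range_add_one (n := n))
    (f := fun i ω => |paramEntry (Θ ω) i - w i|)
    fun i _ => (((continuous_paramEntry i).sub continuous_const).abs).measurable.comp hΘ
  convert this using 1
  ext ω
  simp [paramDist, Finset.sup'_apply]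

/-- Distance from the best of `K` initializations to a target parameter sequence. -/
noncomputable def bestDist {Ω : Type*} {d K : ℕ} (hK : 0 < K) (n : ℕ) (Θ : ℕ → Ω → (Fin d → ℝ)) (w : ℕ → ℝ)
    (ω : Ω) : ℝ :=
  (Finset.Icc 1 K).inf' (Finset.nonempty_Icc.2 hK) fun k => paramDist n (paramEntry (Θ k ω)) w

theorem bestDist_nonneg {Ω : Type*} {d K : ℕ} (hK : 0 < K) (n : ℕ) (Θ : ℕ → Ω → (Fin d → ℝ))
    (w : ℕ → ℝ) (ω : Ω) : 0 ≤ bestDist hK n Θ w ω :=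
  Finset.le_inf' _ _ fun _ _ => paramDist_nonneg _ _ _

theorem measurable_bestDist {Ω : Type*} [MeasurableSpace Ω] {d K : ℕ} (hK : 0 < K) (n : ℕ)
    {Θ : ℕ → Ω → (Fin d → ℝ)} (hΘ : ∀ k, Measurable (Θ k)) (w : ℕ → ℝ) :
    Measurable (bestDist hK n Θ w) := by
  have : Measurable ((Finset.Icc 1 K).inf' (Finset.nonempty_Icc.2 hK)
      fun k ω => paramDist n (paramEntry (Θ k ω)) w) :=
    Finset.inf'_induction _ _ (fun _ h _ h' => h.inf h') fun k _ => measurable_paramDist (hΘ k) w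
  convert this using 1
  ext ω
  simp [bestDist, Finset.inf'_apply]

theorem ae_mem_Icc_of_isUniform {Ω : Type*} [MeasurableSpace Ω] {P : Measure Ω}
    [IsProbabilityMeasure P] {d : ℕ} {c : ℝ} (hc : 0 < c) {Θ : Ω → (Fin d → ℝ)}
    (hΘ : Measurable Θ)
    (hunif : pdf.IsUniform Θ (Set.Icc (fun _ => -c) (fun _ => c)) P volume) :
    ∀ᵐ ω ∂P, ‖Θ ω‖ ≤ c := by
  have hvol : (volume : Measure (Fin d → ℝ)) (Set.Icc (fun _ => -c) (fun _ => c))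
      = ENNReal.ofReal ((2 * c) ^ d) := by
    rw [Real.volume_Icc_pi]
    simp only [Finset.prod_const, Finset.card_univ, Fintype.card_fin]
    rw [← ENNReal.ofReal_pow (by linarith)]
    congr 2; ring
  have h := hunif.measure_preimage (by rw [hvol]; simpa using by positivity) (by rw [hvol]; simp)
    (measurableSet_Icc (a := (fun _ : Fin d => -c)) (b := fun _ => c))
  rw [Set.inter_self, ENNReal.div_self (by rw [hvol]; simpa using by positivity)
    (by rw [hvol]; simp)] at h
  have h2 : ∀ᵐ ω ∂P, Θ ω ∈ Set.Icc (fun _ => -c) (fun _ => c) :=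
    (mem_ae_iff_prob_eq_one (hΘ measurableSet_Icc)).2 h
  filter_upwards [h2] with ω hω
  exact (pi_norm_le_iff_of_nonneg hc.le).2 fun i => abs_le.2 ⟨hω.1 i, hω.2 i⟩

/-- One initialization lies within `2ct` of `w` with probability at least `t ^ (n + 1) = y / K`; by
independence all `K` miss with probability at most `(1 - y / K) ^ K ≤ exp (-y)`. -/
theorem measure_bestDist_pow_gt_le {Ω : Type*} [MeasurableSpace Ω] {P : Measure Ω}
    [IsProbabilityMeasure P] {d K n : ℕ} (hK : 0 < K) (hn : n + 1 ≤ d) {c : ℝ} (hc : 0 < c)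
    {Θ : ℕ → Ω → (Fin d → ℝ)} (hΘ : ∀ k, Measurable (Θ k))
    (hindep : iIndepFun (fun (k : Set.Icc 1 K) => Θ k) P)
    (hident : ∀ i ∈ Set.Icc 1 K, ∀ j ∈ Set.Icc 1 K, IdentDistrib (Θ i) (Θ j) P P)
    (hunif : pdf.IsUniform (Θ 1) (Set.Icc (fun _ => -c) (fun _ => c)) P volume)
    {w : ℕ → ℝ} (hw : ∀ i, |w i| ≤ c) {y : ℝ} (hy : 0 < y) :
    P {ω | y < K * (bestDist hK n Θ w ω / (2 * c)) ^ (n + 1)}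
      ≤ ENNReal.ofReal (Real.exp (-y)) := by
  have hK' : (0 : ℝ) < K := by exact_mod_cast hK
  have h1K : 1 ∈ Set.Icc 1 K := ⟨le_rfl, hK⟩
  -- Here the required radius would reach the full side `2c`; the event is null because almost
  -- surely the first initialization lies in the cube, at distance at most `2c` from `w`.
  by_cases hyK : K ≤ y
  · have h0 : P {ω | y < K * (bestDist hK n Θ w ω / (2 * c)) ^ (n + 1)} = 0 := by
      have h1 := ae_mem_Icc_of_isUniform hc (hΘ 1) hunif
      have : ∀ᵐ ω ∂P, ¬ (y < K * (bestDist hK n Θ w ω / (2 * c)) ^ (n + 1)) := by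
        filter_upwards [h1] with ω hω
        have h2 : bestDist hK n Θ w ω ≤ 2 * c := by
          refine (Finset.inf'_le _ (Finset.mem_Icc.2 h1K)).trans (paramDist_le_iff.2 fun i _ => ?_)
          have h3 := (abs_paramEntry_le (Θ 1 ω) i).trans hω
          have := abs_sub (paramEntry (Θ 1 ω) i) (w i)
          linarith [hw i]
        have h3 : (bestDist hK n Θ w ω / (2 * c)) ^ (n + 1) ≤ 1 :=
          pow_le_one₀ (div_nonneg (bestDist_nonneg ..) (by positivity))
            ((div_le_one (by positivity)).2 h2)
        rw [not_lt]
        nlinarith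
      simpa [ae_iff] using this
    rw [h0]; exact zero_le
  · have hyK : y < K := not_le.1 hyK
    set t : ℝ := (y / K) ^ ((n + 1 : ℕ) : ℝ)⁻¹ with ht
    have hyK0 : 0 ≤ y / K := by positivity
    have htn : t ^ (n + 1) = y / K := Real.rpow_inv_natCast_pow hyK0 (Nat.succ_ne_zero n)
    have ht0 : 0 ≤ t := by positivity
    have ht1 : t ≤ 1 := Real.rpow_le_one hyK0 ((div_le_one hK').2 hyK.le) (by positivity)
    set B : Set (Fin d → ℝ) := {θ | ∀ i < n + 1, |paramEntry θ i - w i| ≤ 2 * c * t} with hB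
    have hBm : MeasurableSet B := by
      simp only [hB, Set.ofPred_forall]
      refine MeasurableSet.iInter fun i => MeasurableSet.iInter fun _ => ?_
      exact measurableSet_le (((continuous_paramEntry i).sub continuous_const).abs).measurable
        measurable_const
    have hsub : {ω | y < K * (bestDist hK n Θ w ω / (2 * c)) ^ (n + 1)} ⊆
        ⋂ k ∈ (Finset.univ : Finset (Set.Icc 1 K)), (fun ω => Θ k ω) ⁻¹' Bᶜ := by
      intro ω hω
      simp only [Set.mem_iInter, Set.mem_preimage, Set.mem_compl_iff]
      intro k _ hk
      have h2 : bestDist hK n Θ w ω ≤ 2 * c * t :=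
        (Finset.inf'_le _ (Finset.mem_Icc.2 k.2)).trans (paramDist_le_iff.2 hk)
      have h3 : (bestDist hK n Θ w ω / (2 * c)) ^ (n + 1) ≤ t ^ (n + 1) := by
        refine pow_le_pow_left₀ (div_nonneg (bestDist_nonneg ..) (by positivity)) ?_ _
        rw [div_le_iff₀ (by positivity)]; linarith
      rw [htn, le_div_iff₀ hK'] at h3
      have hω : y < K * (bestDist hK n Θ w ω / (2 * c)) ^ (n + 1) := hω
      linarith
    refine (measure_mono hsub).trans ?_
    rw [hindep.measure_inter_preimage_eq_mul _ (fun k _ => hBm.compl)]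
    have hle : ∀ k : Set.Icc 1 K, P (Θ k ⁻¹' Bᶜ) ≤ ENNReal.ofReal (1 - y / K) := by
      intro k
      rw [(hident k k.2 1 h1K).measure_mem_eq hBm.compl, Set.preimage_compl,
        prob_compl_eq_one_sub (hΘ 1 hBm), ENNReal.ofReal_sub _ hyK0, ENNReal.ofReal_one]
      refine tsub_le_tsub_left ?_ _
      rw [← htn]
      exact le_measure_paramEntry_sub_le hn hc hunif hw ht0 ht1
    refine (Finset.prod_le_prod' fun k _ => hle k).trans ?_
    have hsubn : 0 ≤ 1 - y / K := sub_nonneg.2 ((div_le_one hK').2 hyK.le)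
    rw [Finset.prod_const, Finset.card_univ, ← ENNReal.ofReal_pow hsubn]
    refine ENNReal.ofReal_le_ofReal ?_
    have hcard : Fintype.card (Set.Icc 1 K) = K := by simp
    rw [hcard]
    calc (1 - y / K) ^ K ≤ (Real.exp (-(y / K))) ^ K :=
          pow_le_pow_left₀ hsubn (Real.one_sub_le_exp_neg _) _
      _ = Real.exp (-y) := by rw [← Real.exp_nat_mul]; congr 1; field_simp

/-! ### Empirical risk, true risk and the L² error -/

/-- The empirical risk of the clipped shallow network with parameters `w`. -/
noncomputable def empRisk {Ω : Type*} {M : ℕ} (u v : ℝ) (ℓ : ℕ) (X Y : Fin M → Ω → ℝ) (w : ℕ → ℝ) (ω : Ω) : ℝ :=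
  1 / (M : ℝ) * ∑ j, |clipping u v (shallowSum ℓ w (X j ω)) - Y j ω| ^ 2

/-- The true risk of the clipped shallow network with parameters `w`. -/
noncomputable def trueRisk {Ω : Type*} [MeasurableSpace Ω] (P : Measure Ω) (u v : ℝ) (ℓ : ℕ) (X Y : Ω → ℝ)
    (w : ℕ → ℝ) : ℝ :=
  ∫ ω, |clipping u v (shallowSum ℓ w (X ω)) - Y ω| ^ 2 ∂P

theorem sq_abs_sub_mem_Icc {u v x y : ℝ} (hx : x ∈ Set.Icc u v) (hy : y ∈ Set.Icc u v) :
    |x - y| ^ 2 ∈ Set.Icc 0 ((v - u) ^ 2) := by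
  refine ⟨by positivity, ?_⟩
  have : |x - y| ≤ v - u := abs_sub_le_iff.2 ⟨by linarith [hx.2, hy.1], by linarith [hy.2, hx.1]⟩
  gcongr

/-- The difference of squares factors as `(p + q - 2y)(p - q)`. Clipping bounds the first factor by
`2 (v - u)`; the second is Lipschitz in the parameters. -/
theorem abs_sq_loss_sub_le {u v c B δ x y : ℝ} {ℓ : ℕ} {w w' : ℕ → ℝ} (huv : u ≤ v)
    (hc : 1 ≤ c) (hw : ∀ i < 3 * ℓ + 1, |w i| ≤ B) (hw' : ∀ i < 3 * ℓ + 1, |w' i| ≤ B)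
    (hδ : ∀ i < 3 * ℓ + 1, |w i - w' i| ≤ δ) (hx : |x| ≤ c) (hy : y ∈ Set.Icc u v) :
    |(|clipping u v (shallowSum ℓ w x) - y| ^ 2 - |clipping u v (shallowSum ℓ w' x) - y| ^ 2)|
      ≤ 2 * (v - u) * ((1 + 4 * ℓ * B * c) * δ) := by
  set p := clipping u v (shallowSum ℓ w x)
  set q := clipping u v (shallowSum ℓ w' x)
  have h1 : |p - q| ≤ (1 + 4 * ℓ * B * c) * δ :=
    (abs_clipping_sub_le ..).trans (abs_shallowSum_sub_le hc hw hw' hδ hx)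
  have hp : p ∈ Set.Icc u v := clipping_mem huv _
  have hq : q ∈ Set.Icc u v := clipping_mem huv _
  have h2 : |p + q - 2 * y| ≤ 2 * (v - u) :=
    abs_le.2 ⟨by linarith [hp.1, hq.1, hy.2], by linarith [hp.2, hq.2, hy.1]⟩
  have e : |p - y| ^ 2 - |q - y| ^ 2 = (p + q - 2 * y) * (p - q) := by
    rw [sq_abs, sq_abs]; ring
  rw [e, abs_mul]
  have := abs_nonneg (p - q)
  gcongr

theorem abs_empRisk_sub_le {Ω : Type*} {M : ℕ} (hM : 0 < M) {u v a b c B δ : ℝ} {ℓ : ℕ}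
    {w w' : ℕ → ℝ} (huv : u ≤ v)
    (hc : 1 ≤ c) (hca : |a| ≤ c) (hcb : |b| ≤ c)
    (hw : ∀ i < 3 * ℓ + 1, |w i| ≤ B) (hw' : ∀ i < 3 * ℓ + 1, |w' i| ≤ B)
    (hδ : ∀ i < 3 * ℓ + 1, |w i - w' i| ≤ δ) {X Y : Fin M → Ω → ℝ}
    (hXmem : ∀ j ω, X j ω ∈ Set.Icc a b) (hYmem : ∀ j ω, Y j ω ∈ Set.Icc u v) (ω : Ω) :
    |empRisk u v ℓ X Y w ω - empRisk u v ℓ X Y w' ω| ≤ 2 * (v - u) * ((1 + 4 * ℓ * B * c) * δ) := by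
  have hM' : (0 : ℝ) < M := by exact_mod_cast hM
  unfold empRisk
  rw [← mul_sub, ← Finset.sum_sub_distrib, abs_mul, abs_of_pos (by positivity), one_div,
    inv_mul_le_iff₀ hM']
  refine (Finset.abs_sum_le_sum_abs _ _).trans ?_
  refine (Finset.sum_le_card_nsmul _ _ _ fun j _ =>
    abs_sq_loss_sub_le huv hc hw hw' hδ ?_ (hYmem j ω)).trans ?_
  · have := hXmem j ω
    exact abs_le.2 ⟨by linarith [(abs_le.1 hca).1, this.1], by linarith [(abs_le.1 hcb).2, this.2]⟩
  · simp

theorem integrable_sq_abs_sub {Ω : Type*} [MeasurableSpace Ω] {P : Measure Ω}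
    [IsProbabilityMeasure P] {u v : ℝ} {f g : Ω → ℝ} (hf : Measurable f) (hg : Measurable g)
    (hfm : ∀ ω, f ω ∈ Set.Icc u v) (hgm : ∀ ω, g ω ∈ Set.Icc u v) :
    Integrable (fun ω => |f ω - g ω| ^ 2) P :=
  Integrable.of_mem_Icc 0 ((v - u) ^ 2) (by fun_prop)
    (Filter.Eventually.of_forall fun ω => sq_abs_sub_mem_Icc (hfm ω) (hgm ω))

theorem abs_trueRisk_sub_le {Ω : Type*} [MeasurableSpace Ω] {P : Measure Ω}
    [IsProbabilityMeasure P] {u v a b c B δ : ℝ} {ℓ : ℕ} {w w' : ℕ → ℝ} (huv : u ≤ v)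
    (hc : 1 ≤ c) (hca : |a| ≤ c) (hcb : |b| ≤ c)
    (hw : ∀ i < 3 * ℓ + 1, |w i| ≤ B) (hw' : ∀ i < 3 * ℓ + 1, |w' i| ≤ B)
    (hδ : ∀ i < 3 * ℓ + 1, |w i - w' i| ≤ δ) {X Y : Ω → ℝ} (hX : Measurable X) (hY : Measurable Y)
    (hXmem : ∀ ω, X ω ∈ Set.Icc a b) (hYmem : ∀ ω, Y ω ∈ Set.Icc u v) :
    |trueRisk P u v ℓ X Y w - trueRisk P u v ℓ X Y w'|
      ≤ 2 * (v - u) * ((1 + 4 * ℓ * B * c) * δ) := by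
  have hint : ∀ w, Integrable (fun ω => |clipping u v (shallowSum ℓ w (X ω)) - Y ω| ^ 2) P :=
    fun w => integrable_sq_abs_sub
      (((continuous_clipping u v).comp (continuous_shallowSum ℓ w)).measurable.comp hX) hY
      (fun _ => clipping_mem huv _) hYmem
  unfold trueRisk
  rw [← integral_sub (hint w) (hint w')]
  have := norm_integral_le_of_norm_le_const (μ := P)
    (Filter.Eventually.of_forall fun ω => ?_ : ∀ᵐ ω ∂P,
      ‖|clipping u v (shallowSum ℓ w (X ω)) - Y ω| ^ 2
        - |clipping u v (shallowSum ℓ w' (X ω)) - Y ω| ^ 2‖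
        ≤ 2 * (v - u) * ((1 + 4 * ℓ * B * c) * δ))
  · simpa using this
  · have h := hXmem ω
    exact abs_sq_loss_sub_le huv hc hw hw' hδ
      (abs_le.2 ⟨by linarith [(abs_le.1 hca).1, h.1], by linarith [(abs_le.1 hcb).2, h.2]⟩)
      (hYmem ω)

theorem sqL2Error_map_eq {Ω : Type*} [MeasurableSpace Ω] {P : Measure Ω} {a b : ℝ} {X : Ω → ℝ}
    (hX : Measurable X) (hXmem : ∀ ω, X ω ∈ Set.Icc a b) {f g : ℝ → ℝ}
    (hf : Measurable f) (hg : Measurable g) :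
    sqL2Error (P.map X) a b f g = ∫ ω, |f (X ω) - g (X ω)| ^ 2 ∂P := by
  unfold sqL2Error
  rw [setIntegral_map measurableSet_Icc (by fun_prop) hX.aemeasurable,
    show X ⁻¹' Set.Icc a b = Set.univ from Set.eq_univ_of_forall hXmem, setIntegral_univ]

/-- Bias-variance decomposition of the quadratic risk. -/
theorem integral_sq_sub_eq_sqL2Error_add {Ω : Type*} [MeasurableSpace Ω] {P : Measure Ω}
    [IsProbabilityMeasure P] {u v a b : ℝ} {X Y : Ω → ℝ} (hX : Measurable X) (hY : Measurable Y)
    (hXmem : ∀ ω, X ω ∈ Set.Icc a b) (hYmem : ∀ ω, Y ω ∈ Set.Icc u v)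
    {E : ℝ → ℝ} (hE : Measurable E) (hEmem : ∀ x, E x ∈ Set.Icc u v)
    (hcond : (fun ω => E (X ω)) =ᵐ[P] P[Y | MeasurableSpace.comap X inferInstance])
    {f : ℝ → ℝ} (hf : Measurable f) (hfm : ∀ x, f x ∈ Set.Icc u v) :
    ∫ ω, |f (X ω) - Y ω| ^ 2 ∂P
      = sqL2Error (P.map X) a b f E + ∫ ω, |E (X ω) - Y ω| ^ 2 ∂P := by
  rw [sqL2Error_map_eq hX hXmem hf hE]
  have hfX := hf.comp hX
  have hEX := hE.comp hX
  have hYint : Integrable Y P :=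
    Integrable.of_mem_Icc u v hY.aemeasurable (Filter.Eventually.of_forall hYmem)
  have hm : MeasurableSpace.comap X inferInstance ≤ (inferInstance : MeasurableSpace Ω) :=
    hX.comap_le
  set h : Ω → ℝ := fun ω => f (X ω) - E (X ω) with hh
  have hhm : StronglyMeasurable[MeasurableSpace.comap X inferInstance] h :=
    ((hf.sub hE).comp (comap_measurable X)).stronglyMeasurable
  have hhb : ∀ ω, ‖h ω‖ ≤ v - u := fun ω => abs_sub_le_iff.2
    ⟨by linarith [(hfm (X ω)).2, (hEmem (X ω)).1], by linarith [(hfm (X ω)).1, (hEmem (X ω)).2]⟩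
  have hpull := condExp_stronglyMeasurable_mul_of_bound hm hhm hYint (v - u)
    (Filter.Eventually.of_forall hhb)
  -- The cross term vanishes: `h` is a function of `X`, so it can be pulled out of the conditional
  -- expectation of `h * Y`.
  have hcross : ∫ ω, h ω * E (X ω) ∂P = ∫ ω, h ω * Y ω ∂P := by
    rw [← integral_condExp hm (f := fun ω => h ω * Y ω)]
    refine integral_congr_ae ?_
    filter_upwards [hpull, hcond] with ω h1 h2
    have h1 : (P[fun ω => h ω * Y ω | MeasurableSpace.comap X inferInstance]) ω
      = h ω * (P[Y | MeasurableSpace.comap X inferInstance]) ω := h1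
    rw [h1, h2]
  have hhM : Measurable h := hfX.sub hEX
  have i1 : Integrable (fun ω => h ω * E (X ω)) P :=
    (Integrable.of_mem_Icc u v hEX.aemeasurable
      (Filter.Eventually.of_forall fun ω => hEmem (X ω))).bdd_mul hhM.aestronglyMeasurable
      (Filter.Eventually.of_forall hhb)
  have i2 : Integrable (fun ω => h ω * Y ω) P :=
    hYint.bdd_mul hhM.aestronglyMeasurable (Filter.Eventually.of_forall hhb)
  have i3 := integrable_sq_abs_sub (P := P) hfX hEX (fun ω => hfm (X ω)) (fun ω => hEmem (X ω))
  have i4 := integrable_sq_abs_sub (P := P) hEX hY (fun ω => hEmem (X ω)) hYmem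
  simp only [Function.comp_def] at i3 i4
  have e : ∀ ω, |f (X ω) - Y ω| ^ 2 = (|f (X ω) - E (X ω)| ^ 2 + |E (X ω) - Y ω| ^ 2)
      + 2 * (h ω * E (X ω) - h ω * Y ω) := by
    intro ω; simp only [sq_abs, hh]; ring
  simp only [e]
  have i5 : Integrable (fun ω => |f (X ω) - E (X ω)| ^ 2 + |E (X ω) - Y ω| ^ 2) P := i3.add i4
  have i6 : Integrable (fun ω => 2 * (h ω * E (X ω) - h ω * Y ω)) P := (i1.sub i2).const_mul 2
  rw [integral_add i5 i6, integral_add i3 i4,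
    integral_const_mul, integral_sub i1 i2, hcross, sub_self, mul_zero, add_zero]

/-! ### Uniform deviation over the parameter cube -/

/-- A point of the uniform grid on `[-β, β]`-valued parameter sequences. -/
noncomputable def gridParam (m n : ℕ) (β : ℝ) (k : Fin m → Fin (n + 1)) (i : ℕ) : ℝ :=
  if h : i < m then -β + 2 * β * (k ⟨i, h⟩ : ℕ) / n else 0

theorem abs_gridParam_le {m n : ℕ} (hn : 0 < n) {β : ℝ} (hβ : 0 ≤ β) (k : Fin m → Fin (n + 1))
    (i : ℕ) : |gridParam m n β k i| ≤ β := by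
  have hn' : (0 : ℝ) < n := by exact_mod_cast hn
  unfold gridParam
  split
  · rename_i h
    have h1 : ((k ⟨i, h⟩ : ℕ) : ℝ) ≤ n := by exact_mod_cast Nat.lt_succ_iff.1 (k ⟨i, h⟩).2
    have h2 : 2 * β * (k ⟨i, h⟩ : ℕ) / n ≤ 2 * β := by
      rw [div_le_iff₀ hn']; gcongr
    have h3 : 0 ≤ 2 * β * (k ⟨i, h⟩ : ℕ) / n := by positivity
    exact abs_le.2 ⟨by linarith, by linarith⟩
  · simpa using hβ

theorem exists_gridParam_close {m n : ℕ} (hn : 0 < n) {β : ℝ} (hβ : 0 < β) {w : ℕ → ℝ}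
    (hw : ∀ i < m, |w i| ≤ β) :
    ∃ k : Fin m → Fin (n + 1), ∀ i < m, |w i - gridParam m n β k i| ≤ 2 * β / n := by
  have hn' : (0 : ℝ) < n := by exact_mod_cast hn
  have hb : ∀ i < m, 0 ≤ (w i + β) * n / (2 * β) ∧ (w i + β) * n / (2 * β) ≤ n := by
    intro i hi
    have := abs_le.1 (hw i hi)
    refine ⟨div_nonneg (mul_nonneg (by linarith) hn'.le) (by positivity), ?_⟩
    rw [div_le_iff₀ (by positivity), mul_comm (n : ℝ)]
    gcongr
    linarith
  -- Each coordinate is rounded down to the grid of mesh `2β / n`.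
  refine ⟨fun i => ⟨⌊(w i + β) * n / (2 * β)⌋₊,
    Nat.lt_succ_of_le (Nat.floor_le_of_le (hb i i.2).2)⟩, fun i hi => ?_⟩
  simp only [gridParam, hi, dif_pos]
  set r := (w i + β) * n / (2 * β) with hr
  have e : w i - (-β + 2 * β * (⌊r⌋₊ : ℕ) / n) = (r - ⌊r⌋₊) * (2 * β / n) := by
    rw [hr]; field_simp; ring
  have h1 := Nat.floor_le (hb i hi).1
  have h2 := (Nat.lt_floor_add_one r).le
  rw [e, abs_of_nonneg (mul_nonneg (by linarith) (by positivity))]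
  exact mul_le_of_le_one_left (by positivity) (by linarith)

theorem measurable_sq_loss (u v : ℝ) (ℓ : ℕ) (w : ℕ → ℝ) :
    Measurable fun q : ℝ × ℝ => |clipping u v (shallowSum ℓ w q.1) - q.2| ^ 2 := by
  have := ((continuous_clipping u v).comp (continuous_shallowSum ℓ w)).comp
    (continuous_fst (X := ℝ) (Y := ℝ))
  exact ((this.sub continuous_snd).abs.pow 2).measurable

theorem measurable_sq_loss_comp {Ω : Type*} [MeasurableSpace Ω] (u v : ℝ) (ℓ : ℕ) (w : ℕ → ℝ)
    {X Y : Ω → ℝ} (hX : Measurable X) (hY : Measurable Y) :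
    Measurable fun ω => |clipping u v (shallowSum ℓ w (X ω)) - Y ω| ^ 2 := by
  have h1 : Measurable fun ω => clipping u v (shallowSum ℓ w (X ω)) :=
    ((continuous_clipping u v).comp (continuous_shallowSum ℓ w)).measurable.comp hX
  fun_prop

theorem exists_tail_abs_empRisk_sub_trueRisk_le_of_finite {Ω : Type*} [MeasurableSpace Ω]
    {P : Measure Ω} [IsProbabilityMeasure P] {M : ℕ} (hM : 0 < M) {u v : ℝ} (ℓ : ℕ) (huv : u < v)
    {X Y : Fin M → Ω → ℝ} (hX : ∀ j, Measurable (X j)) (hY : ∀ j, Measurable (Y j))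
    (hYmem : ∀ j ω, Y j ω ∈ Set.Icc u v)
    (hindep : iIndepFun (fun j ω => (X j ω, Y j ω)) P)
    (hident : ∀ i j, IdentDistrib (fun ω => (X i ω, Y i ω)) (fun ω => (X j ω, Y j ω)) P P)
    {ι : Type*} [Fintype ι] [Nonempty ι] (g : ι → ℕ → ℝ) :
    ∃ T : Ω → ℝ, Measurable T ∧
      (∀ y : ℝ, 0 < y → P {ω | y < T ω} ≤ ENNReal.ofReal (Real.exp (-y))) ∧
      ∀ ω k, |empRisk u v ℓ X Y (g k) ω - trueRisk P u v ℓ (X ⟨0, hM⟩) (Y ⟨0, hM⟩) (g k)|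
        ≤ (v - u) ^ 2 * √((max (T ω) 0 + Real.log (2 * Fintype.card ι)) / (2 * M)) := by
  have hD : 0 < (v - u) ^ 2 := by have := sub_pos.2 huv; positivity
  exact exists_tail_abs_mean_sub_le (P := P) hM hD
    (f := fun k j ω => |clipping u v (shallowSum ℓ (g k) (X j ω)) - Y j ω| ^ 2)
    (m := fun k => trueRisk P u v ℓ (X ⟨0, hM⟩) (Y ⟨0, hM⟩) (g k))
    (fun k j => measurable_sq_loss_comp u v ℓ (g k) (hX j) (hY j))
    (fun k j ω => sq_abs_sub_mem_Icc (clipping_mem huv.le _) (hYmem j ω))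
    (fun k => hindep.comp (fun _ q => |clipping u v (shallowSum ℓ (g k) q.1) - q.2| ^ 2)
      (fun _ => measurable_sq_loss u v ℓ (g k)))
    (fun k j => ((hident j ⟨0, hM⟩).comp (measurable_sq_loss u v ℓ (g k))).integral_eq)

/-- Uniform deviation of the empirical risk, controlled by a random variable with exponential
tail. -/
theorem exists_tail_abs_empRisk_sub_trueRisk_le {Ω : Type*} [MeasurableSpace Ω] {P : Measure Ω}
    [IsProbabilityMeasure P] {M : ℕ} (hM : 0 < M) {u v a b c β : ℝ} (ℓ : ℕ) (huv : u < v)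
    (hc : 1 ≤ c) (hca : |a| ≤ c) (hcb : |b| ≤ c) (hβ : 0 < β) {n : ℕ} (hn : 0 < n)
    {X Y : Fin M → Ω → ℝ} (hX : ∀ j, Measurable (X j)) (hY : ∀ j, Measurable (Y j))
    (hXmem : ∀ j ω, X j ω ∈ Set.Icc a b) (hYmem : ∀ j ω, Y j ω ∈ Set.Icc u v)
    (hindep : iIndepFun (fun j ω => (X j ω, Y j ω)) P)
    (hident : ∀ i j, IdentDistrib (fun ω => (X i ω, Y i ω)) (fun ω => (X j ω, Y j ω)) P P) :
    ∃ T : Ω → ℝ, Measurable T ∧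
      (∀ y : ℝ, 0 < y → P {ω | y < T ω} ≤ ENNReal.ofReal (Real.exp (-y))) ∧
      ∀ ω w, (∀ i < 3 * ℓ + 1, |w i| ≤ β) →
        |empRisk u v ℓ X Y w ω - trueRisk P u v ℓ (X ⟨0, hM⟩) (Y ⟨0, hM⟩) w|
        ≤ (v - u) ^ 2 * √((max (T ω) 0 + Real.log (2 * ((n : ℝ) + 1) ^ (3 * ℓ + 1))) / (2 * M))
          + 4 * (v - u) * ((1 + 4 * ℓ * β * c) * (2 * β / n)) := by
  have hM' : (0 : ℝ) < M := by exact_mod_cast hM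
  have hD : 0 < (v - u) ^ 2 := by have := sub_pos.2 huv; positivity
  obtain ⟨T, hTm, hTtail, hT⟩ := exists_tail_abs_empRisk_sub_trueRisk_le_of_finite hM ℓ huv
    hX hY hYmem hindep hident (gridParam (3 * ℓ + 1) n β)
  have hcard : ((Fintype.card (Fin (3 * ℓ + 1) → Fin (n + 1)) : ℕ) : ℝ)
      = ((n : ℝ) + 1) ^ (3 * ℓ + 1) := by
    rw [Fintype.card_fun, Fintype.card_fin, Fintype.card_fin]; push_cast; rfl
  rw [hcard] at hT
  refine ⟨T, hTm, hTtail, fun ω w hw => ?_⟩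
  -- Moving to the grid point changes both risks, hence `4 (v - u)`, twice the single Lipschitz
  -- constant.
  obtain ⟨k, hk⟩ := exists_gridParam_close hn hβ hw
  have hgk : ∀ i < 3 * ℓ + 1, |gridParam (3 * ℓ + 1) n β k i| ≤ β := fun i _ => abs_gridParam_le hn hβ.le k i
  have h1 := abs_empRisk_sub_le hM huv.le hc hca hcb hw hgk hk hXmem hYmem ω
  have h2 := abs_trueRisk_sub_le (P := P) huv.le hc hca hcb hw hgk hk (hX ⟨0, hM⟩) (hY ⟨0, hM⟩)
    (hXmem ⟨0, hM⟩) (hYmem ⟨0, hM⟩)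
  have h4 := hT ω k
  rw [abs_le] at h1 h2 h4 ⊢
  constructor <;> linarith

/-! ### Error decomposition -/

/-- Deterministic error decomposition for an approximate empirical risk minimizer. -/
theorem sqL2Error_le_of_empRisk_le {Ω : Type*} [MeasurableSpace Ω] {P : Measure Ω}
    [IsProbabilityMeasure P] {M : ℕ} (hM : 0 < M) {u v a b c β A δ G : ℝ} {ℓ : ℕ} (huv : u ≤ v)
    (hc : 1 ≤ c) (hca : |a| ≤ c) (hcb : |b| ≤ c) (hβ : c ≤ β)
    {X Y : Fin M → Ω → ℝ} (hX : ∀ j, Measurable (X j)) (hY : ∀ j, Measurable (Y j))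
    (hXmem : ∀ j ω, X j ω ∈ Set.Icc a b) (hYmem : ∀ j ω, Y j ω ∈ Set.Icc u v)
    {E : ℝ → ℝ} (hE : Measurable E) (hEmem : ∀ x, E x ∈ Set.Icc u v)
    (hcond : (fun ω => E (X ⟨0, hM⟩ ω)) =ᵐ[P]
      P[Y ⟨0, hM⟩ | MeasurableSpace.comap (X ⟨0, hM⟩) inferInstance])
    {w₀ : ℕ → ℝ} (hw₀ : ∀ i, |w₀ i| ≤ c)
    (happrox : ∀ x ∈ Set.Icc a b, |shallowSum ℓ w₀ x - E x| ≤ A)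
    {ω : Ω} (hG : ∀ w, (∀ i < 3 * ℓ + 1, |w i| ≤ β) →
      |empRisk u v ℓ X Y w ω - trueRisk P u v ℓ (X ⟨0, hM⟩) (Y ⟨0, hM⟩) w| ≤ G)
    {w w' : ℕ → ℝ} (hw : ∀ i < 3 * ℓ + 1, |w i| ≤ β) (hw' : ∀ i < 3 * ℓ + 1, |w' i| ≤ c)
    (hδ : ∀ i < 3 * ℓ + 1, |w' i - w₀ i| ≤ δ)
    (hle : empRisk u v ℓ X Y w ω ≤ empRisk u v ℓ X Y w' ω) :
    sqL2Error (P.map (X ⟨0, hM⟩)) a b (fun x => clipping u v (shallowSum ℓ w x)) E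
      ≤ A ^ 2 + 2 * (v - u) * ((1 + 4 * ℓ * c * c) * δ) + 2 * G := by
  have hnet : ∀ w, Measurable fun x => clipping u v (shallowSum ℓ w x) := fun w =>
    ((continuous_clipping u v).comp (continuous_shallowSum ℓ w)).measurable
  have hdec := fun w => integral_sq_sub_eq_sqL2Error_add (P := P) (hX ⟨0, hM⟩) (hY ⟨0, hM⟩)
    (hXmem ⟨0, hM⟩) (hYmem ⟨0, hM⟩) hE hEmem hcond (hnet w) (fun _ => clipping_mem huv _)
  have hA : sqL2Error (P.map (X ⟨0, hM⟩)) a b (fun x => clipping u v (shallowSum ℓ w₀ x)) E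
      ≤ A ^ 2 := by
    rw [sqL2Error_map_eq (hX ⟨0, hM⟩) (hXmem ⟨0, hM⟩) (hnet w₀) hE]
    have hint := integrable_sq_abs_sub (P := P) ((hnet w₀).comp (hX ⟨0, hM⟩))
      (hE.comp (hX ⟨0, hM⟩)) (fun _ => clipping_mem huv _) (fun ω => hEmem _)
    refine (integral_mono hint (integrable_const (A ^ 2)) fun ω => ?_).trans_eq (by simp)
    have h := happrox _ (hXmem ⟨0, hM⟩ ω)
    have h2 := abs_clipping_sub_le u v (shallowSum ℓ w₀ (X ⟨0, hM⟩ ω)) (E (X ⟨0, hM⟩ ω))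
    rw [clipping_of_mem (hEmem _)] at h2
    exact pow_le_pow_left₀ (abs_nonneg _) (h2.trans h) 2
  have h1 := hdec w
  have h2 := hdec w₀
  -- The deviation bound is used at `w` and at `w₀`, giving `2 * G`. The initialization `w'` enters
  -- only through empirical risks, so its distance to `w₀` is paid for once, with constant `c` in
  -- place of `β`.
  have h3 := abs_le.1 (hG w hw)
  have h4 := abs_le.1 (hG w₀ fun i _ => (hw₀ i).trans hβ)
  have h5 := abs_le.1 (abs_empRisk_sub_le hM huv hc hca hcb hw' (fun i _ => hw₀ i) hδ hXmem hYmem ω)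
  unfold trueRisk at h3 h4
  linarith [h3.1, h4.2, h5.2]

/-! ### From an almost sure bound to an `L^p` bound -/

theorem sqrt_add_le_sqrt_add_sqrt {x y : ℝ} (hx : 0 ≤ x) (hy : 0 ≤ y) : √(x + y) ≤ √x + √y := by
  rw [Real.sqrt_le_iff]
  refine ⟨by positivity, ?_⟩
  nlinarith [Real.sq_sqrt hx, Real.sq_sqrt hy, mul_nonneg (Real.sqrt_nonneg x) (Real.sqrt_nonneg y)]

theorem integral_rpow_le_of_eLpNorm_le {Ω : Type*} [MeasurableSpace Ω] {P : Measure Ω}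
    [IsProbabilityMeasure P] {F : Ω → ℝ} (hF : Measurable F) (hF0 : ∀ ω, 0 ≤ F ω)
    {D : ℝ} (hFD : ∀ ω, F ω ≤ D) {p B : ℝ} (hp : 0 < p) (hB : 0 ≤ B)
    (h : eLpNorm (fun ω => √(F ω)) (ENNReal.ofReal p) P ≤ ENNReal.ofReal B) :
    (∫ ω, F ω ^ (p / 2) ∂P) ^ (1 / p) ≤ B := by
  have hmem : MemLp (fun ω => √(F ω)) (ENNReal.ofReal p) P := by
    refine MemLp.of_bound hF.sqrt.aestronglyMeasurable (√D)
      (Filter.Eventually.of_forall fun ω => ?_)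
    rw [Real.norm_of_nonneg (Real.sqrt_nonneg _)]
    exact Real.sqrt_le_sqrt (hFD ω)
  rw [hmem.eLpNorm_eq_integral_rpow_norm (by simpa using hp) (by simp),
    ENNReal.ofReal_le_ofReal_iff hB, ENNReal.toReal_ofReal hp.le, ← one_div] at h
  have e : ∀ ω, ‖√(F ω)‖ ^ p = F ω ^ (p / 2) := fun ω => by
    rw [Real.norm_of_nonneg (Real.sqrt_nonneg _), Real.sqrt_eq_rpow, ← Real.rpow_mul (hF0 ω)]
    congr 1
    ring
  simpa only [e] using h

/-- The left side is the `L^p` norm of `√F`. Raising the exponent to `4n ≥ 1` makes Minkowski's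
inequality available also for `p < 1`. Two successive square roots reduce `W` to its `L^n` norm, and
`κ ≤ 1 / 2` gives `4n · κ / 2 ≤ n` for `T`. -/
theorem integral_rpow_le_of_ae_le {Ω : Type*} [MeasurableSpace Ω] {P : Measure Ω}
    [IsProbabilityMeasure P] {F T W : Ω → ℝ} (hF : Measurable F) (hF0 : ∀ ω, 0 ≤ F ω)
    {D : ℝ} (hFD : ∀ ω, F ω ≤ D) (hT : Measurable T) (hT0 : ∀ ω, 0 ≤ T ω)
    (hW : Measurable W) (hW0 : ∀ ω, 0 ≤ W ω) {A C₁ C₂ C₃ κ p BT BW : ℝ} (hA : 0 ≤ A)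
    (hC₁ : 0 ≤ C₁) (hC₂ : 0 ≤ C₂) (hC₃ : 0 ≤ C₃) (hκ0 : 0 < κ) (hκ : κ ≤ 1 / 2) (hp : 0 < p)
    {n : ℕ} (hn : 1 ≤ n) (hpn : p ≤ 4 * n) (hBT : 0 ≤ BT) (hBW : 0 ≤ BW)
    (hTn : eLpNorm T n P ≤ ENNReal.ofReal BT) (hWn : eLpNorm W n P ≤ ENNReal.ofReal BW)
    (hle : ∀ᵐ ω ∂P, F ω ≤ A ^ 2 + C₁ * T ω ^ κ + (C₂ * √(W ω) + C₃)) :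
    (∫ ω, F ω ^ (p / 2) ∂P) ^ (1 / p) ≤ A + √C₁ * BT ^ (κ / 2) + √(C₂ * √BW + C₃) := by
  have hn' : (1 : ℝ) ≤ n := by exact_mod_cast hn
  rw [← ENNReal.ofReal_natCast] at hTn hWn
  refine integral_rpow_le_of_eLpNorm_le hF hF0 hFD hp (by positivity) ?_
  refine (eLpNorm_le_eLpNorm_of_exponent_le (ENNReal.ofReal_le_ofReal hpn)
    hF.sqrt.aestronglyMeasurable).trans ?_
  have m1 : Measurable fun ω => √C₁ * T ω ^ (κ / 2) := (hT.pow_const _).const_mul _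
  have m2' : Measurable fun ω => C₂ * W ω ^ (1 / 2 : ℝ) := (hW.pow_const _).const_mul _
  have m2 : Measurable fun ω => C₂ * W ω ^ (1 / 2 : ℝ) + C₃ := m2'.add_const _
  have hdom : eLpNorm (fun ω => √(F ω)) (ENNReal.ofReal (4 * n)) P ≤
      eLpNorm ((fun _ => A) + (fun ω => √C₁ * T ω ^ (κ / 2))
        + fun ω => (C₂ * W ω ^ (1 / 2 : ℝ) + C₃) ^ (1 / 2 : ℝ)) (ENNReal.ofReal (4 * n)) P := by
    refine eLpNorm_mono_ae_real ?_
    filter_upwards [hle] with ω h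
    have hTκ : 0 ≤ T ω ^ κ := Real.rpow_nonneg (hT0 ω) _
    rw [Real.norm_of_nonneg (Real.sqrt_nonneg _)]
    have e1 : √C₁ * T ω ^ (κ / 2) = √(C₁ * T ω ^ κ) := by
      rw [Real.sqrt_mul hC₁, Real.sqrt_eq_rpow (T ω ^ κ), ← Real.rpow_mul (hT0 ω)]
      congr 2; ring
    simp only [Pi.add_apply, ← Real.sqrt_eq_rpow]
    rw [e1]
    have h2 : 0 ≤ C₂ * √(W ω) + C₃ := by positivity
    calc √(F ω) ≤ √(A ^ 2 + C₁ * T ω ^ κ + (C₂ * √(W ω) + C₃)) := Real.sqrt_le_sqrt h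
      _ ≤ √(A ^ 2 + C₁ * T ω ^ κ) + √(C₂ * √(W ω) + C₃) :=
          sqrt_add_le_sqrt_add_sqrt (by positivity) h2
      _ ≤ √(A ^ 2) + √(C₁ * T ω ^ κ) + √(C₂ * √(W ω) + C₃) := by
          gcongr; exact sqrt_add_le_sqrt_add_sqrt (by positivity) (by positivity)
      _ = _ := by rw [Real.sqrt_sq hA]
  have one_le : ∀ r : ℝ, 1 ≤ r → 1 ≤ ENNReal.ofReal r := fun r hr => by simpa using hr
  have hconst : ∀ (C r : ℝ), 0 ≤ C → 1 ≤ r →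
      eLpNorm (fun _ : Ω => C) (ENNReal.ofReal r) P = ENNReal.ofReal C := by
    intro C r hC hr
    rw [eLpNorm_const _ (by simpa using by linarith) (IsProbabilityMeasure.ne_zero P)]
    simp [Real.enorm_of_nonneg hC]
  have hmul : ∀ (C : ℝ) (f : Ω → ℝ) (r : ENNReal), 0 ≤ C →
      eLpNorm (fun ω => C * f ω) r P = ENNReal.ofReal C * eLpNorm f r P := by
    intro C f r hC
    have := eLpNorm_const_smul C f r P
    rwa [Real.enorm_of_nonneg hC] at this
  have t1 : eLpNorm (fun ω => √C₁ * T ω ^ (κ / 2)) (ENNReal.ofReal (4 * n)) P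
      ≤ ENNReal.ofReal (√C₁ * BT ^ (κ / 2)) := by
    rw [hmul _ _ _ (Real.sqrt_nonneg _), ENNReal.ofReal_mul (Real.sqrt_nonneg _)]
    gcongr
    refine eLpNorm_rpow_le_of_eLpNorm_le hT hT0 (by positivity) ?_ hBT hTn
    rw [← ENNReal.ofReal_mul (by positivity)]
    refine ENNReal.ofReal_le_ofReal ?_
    nlinarith
  have t2 : eLpNorm (fun ω => C₂ * W ω ^ (1 / 2 : ℝ) + C₃) (ENNReal.ofReal (2 * n)) P
      ≤ ENNReal.ofReal (C₂ * √BW + C₃) := by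
    refine (eLpNorm_add_le m2'.aestronglyMeasurable aestronglyMeasurable_const
      (one_le _ (by linarith))).trans ?_
    rw [ENNReal.ofReal_add (by positivity) hC₃, hconst _ _ hC₃ (by linarith), hmul _ _ _ hC₂,
      ENNReal.ofReal_mul hC₂, Real.sqrt_eq_rpow]
    gcongr
    refine eLpNorm_rpow_le_of_eLpNorm_le hW hW0 (by positivity) ?_ hBW hWn
    rw [← ENNReal.ofReal_mul (by positivity)]
    exact ENNReal.ofReal_le_ofReal (by linarith)
  have t3 : eLpNorm (fun ω => (C₂ * W ω ^ (1 / 2 : ℝ) + C₃) ^ (1 / 2 : ℝ))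
      (ENNReal.ofReal (4 * n)) P ≤ ENNReal.ofReal (√(C₂ * √BW + C₃)) := by
    rw [Real.sqrt_eq_rpow (C₂ * √BW + C₃)]
    refine eLpNorm_rpow_le_of_eLpNorm_le m2 (fun ω => ?_) (by positivity) ?_ (by positivity) t2
    · have := Real.rpow_nonneg (hW0 ω) (1 / 2); positivity
    · rw [← ENNReal.ofReal_mul (by positivity)]
      exact ENNReal.ofReal_le_ofReal (by linarith)
  refine hdom.trans ?_
  refine (eLpNorm_add_le (aestronglyMeasurable_const.add m1.aestronglyMeasurable)
    (m2.pow_const _).aestronglyMeasurable (one_le _ (by linarith))).trans ?_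
  rw [ENNReal.ofReal_add (by positivity) (by positivity),
    ENNReal.ofReal_add (by positivity) (by positivity)]
  refine add_le_add ((eLpNorm_add_le aestronglyMeasurable_const m1.aestronglyMeasurable
    (one_le _ (by linarith))).trans ?_) t3
  exact add_le_add (hconst _ _ hA (by linarith)).le t1

/-! ### Explicit constants -/

theorem optimization_term_le {u v c p : ℝ} {K ℓ n : ℕ} (hK : 0 < K) (huv : u ≤ v) (hc : 1 ≤ c)
    (hn : 1 ≤ n) (hnp : (n : ℝ) ≤ max (p / 2) 1) :
    √(2 * (v - u) * (1 + 4 * ℓ * c * c) * (2 * c) * (K : ℝ) ^ (-(1 / ((3 * ℓ + 1 : ℕ) : ℝ))))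
        * (n : ℝ) ^ (1 / ((3 * ℓ + 1 : ℕ) : ℝ) / 2)
      ≤ (8 * (v - u) * ((ℓ : ℝ) + 1) ^ 2 * c ^ 3 * max (p / 2) 1) ^ (1 / 2 : ℝ)
            / (K : ℝ) ^ (((ℓ : ℝ) + 1) ^ (-2 : ℤ) / 4) := by
  have hK' : (1 : ℝ) ≤ K := by exact_mod_cast hK
  have hn' : (1 : ℝ) ≤ n := by exact_mod_cast hn
  have hvu : 0 ≤ v - u := sub_nonneg.2 huv
  have hℓ : (0 : ℝ) ≤ ℓ := Nat.cast_nonneg _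
  set κ : ℝ := 1 / ((3 * ℓ + 1 : ℕ) : ℝ) with hκ
  have hκ0 : 0 ≤ κ := by positivity
  have hκ1 : κ ≤ 1 := by
    rw [hκ, div_le_one (by positivity)]; exact_mod_cast Nat.le_add_left 1 (3 * ℓ)
  -- The sharper rate `1 / (2 (3ℓ + 1))` is weakened via `3ℓ + 1 ≤ 2 (ℓ + 1)²`.
  have hexp : ((ℓ : ℝ) + 1) ^ (-2 : ℤ) / 4 ≤ κ / 2 := by
    have e : ((ℓ : ℝ) + 1) ^ (-2 : ℤ) = 1 / ((ℓ : ℝ) + 1) ^ 2 := by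
      rw [zpow_neg, one_div]; norm_cast
    have : 1 / ((ℓ : ℝ) + 1) ^ 2 ≤ κ * 2 := by
      rw [hκ, div_mul_eq_mul_div, div_le_div_iff₀ (by positivity) (by positivity)]
      push_cast
      nlinarith [sq_nonneg ((ℓ : ℝ) - 1)]
    rw [e]; linarith
  have h1 : (n : ℝ) ^ (κ / 2) ≤ √(max (p / 2) 1) := by
    rw [Real.sqrt_eq_rpow]
    calc (n : ℝ) ^ (κ / 2) ≤ (n : ℝ) ^ (1 / 2 : ℝ) :=
          Real.rpow_le_rpow_of_exponent_le hn' (by linarith)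
      _ ≤ _ := Real.rpow_le_rpow (by positivity) hnp (by positivity)
  have h2 : 2 * (v - u) * (1 + 4 * ℓ * c * c) * (2 * c) ≤ 8 * (v - u) * ((ℓ : ℝ) + 1) ^ 2 * c ^ 3 := by
    have hc2 : 1 ≤ c * c := by nlinarith
    have h3 : 1 + 4 * ℓ * c * c ≤ 2 * ((ℓ : ℝ) + 1) ^ 2 * (c * c) := by
      nlinarith [mul_nonneg (mul_nonneg hℓ hℓ) (by positivity : 0 ≤ c * c)]
    calc _ = 4 * (v - u) * c * (1 + 4 * ℓ * c * c) := by ring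
      _ ≤ 4 * (v - u) * c * (2 * ((ℓ : ℝ) + 1) ^ 2 * (c * c)) := by gcongr
      _ = _ := by ring
  have h4 : √((K : ℝ) ^ (-κ)) = ((K : ℝ) ^ (κ / 2))⁻¹ := by
    rw [Real.sqrt_eq_rpow, ← Real.rpow_mul (by positivity), ← Real.rpow_neg (by positivity)]
    congr 1; ring
  have h5 : 0 ≤ 2 * (v - u) * (1 + 4 * ℓ * c * c) * (2 * c) := by positivity
  have h6 : 0 ≤ 8 * (v - u) * ((ℓ : ℝ) + 1) ^ 2 * c ^ 3 := by positivity
  rw [Real.sqrt_mul h5, h4, ← Real.sqrt_eq_rpow, Real.sqrt_mul h6, div_eq_mul_inv, mul_right_comm]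
  have h7 : ((K : ℝ) ^ (κ / 2))⁻¹ ≤ ((K : ℝ) ^ (((ℓ : ℝ) + 1) ^ (-2 : ℤ) / 4))⁻¹ :=
    inv_anti₀ (by positivity) (Real.rpow_le_rpow_of_exponent_le hK' hexp)
  exact mul_le_mul (mul_le_mul (Real.sqrt_le_sqrt h2) h1 (by positivity) (by positivity)) h7
    (by positivity) (by positivity)

theorem two_mul_le_rpow_three_halves {x : ℝ} (hx : 4 ≤ x) : 2 * x ≤ x ^ (3 / 2 : ℝ) := by
  have h0 : (0 : ℝ) ≤ x := by linarith
  have e : x ^ (3 / 2 : ℝ) = x * √x := by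
    rw [Real.sqrt_eq_rpow, ← Real.rpow_one_add' h0 (by norm_num)]; norm_num
  have h2 : 2 ≤ √x := Real.le_sqrt_of_sq_le (by linarith)
  rw [e]; nlinarith

theorem log_four_gt : (1.38 : ℝ) < Real.log 4 := by
  have : (4 : ℝ) = 2 ^ 2 := by norm_num
  rw [this, Real.log_pow]
  have := Real.log_two_gt_d9
  push_cast; linarith

theorem log_four_lt : Real.log 4 < (1.39 : ℝ) := by
  have : (4 : ℝ) = 2 ^ 2 := by norm_num
  rw [this, Real.log_pow]
  have := Real.log_two_lt_d9
  push_cast; linarith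

/-- This `m` is polynomial in `M β c`: `m + 1 ≤ (4Mβc)²` bounds each factor's logarithm by `2Λ`, and
`log 2 ≤ Λ`. -/
theorem log_grid_card_le {c β Λ : ℝ} {M ℓ m : ℕ} (hM : 0 < M) (hc : 1 ≤ c) (hβ : 1 ≤ β)
    (hΛ : Real.log (4 * (M : ℝ) * β * c) ≤ Λ) (hΛ1 : 1.38 ≤ Λ) (hm : m = ⌈2 * M * β ^ 2 * c⌉₊) :
    Real.log (2 * ((m : ℝ) + 1) ^ (3 * ℓ + 1)) ≤ (6 * ℓ + 3) * Λ := by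
  have hM' : (1 : ℝ) ≤ M := by exact_mod_cast hM
  have hMβc : 1 ≤ M * β * c := one_le_mul_of_one_le_of_one_le
    (one_le_mul_of_one_le_of_one_le hM' hβ) hc
  have hm2 : (m : ℝ) + 1 ≤ (4 * M * β * c) ^ 2 := by
    have h1 : (m : ℝ) < 2 * M * β ^ 2 * c + 1 := hm ▸ Nat.ceil_lt_add_one (by positivity)
    have h2 : M * β ^ 2 * c ≤ (M * β * c) ^ 2 := by
      have : (M * β * c) ^ 2 = (M * β ^ 2 * c) * (M * c) := by ring
      rw [this]
      exact le_mul_of_one_le_right (by positivity) (one_le_mul_of_one_le_of_one_le hM' hc)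
    nlinarith
  rw [Real.log_mul (by norm_num) (by positivity), Real.log_pow]
  have h1 : Real.log ((m : ℝ) + 1) ≤ 2 * Λ := by
    refine (Real.log_le_log (by positivity) hm2).trans ?_
    rw [Real.log_pow]
    push_cast
    linarith
  have h2 : Real.log 2 ≤ Λ := by
    have := Real.log_two_lt_d9
    linarith
  push_cast
  have h3 : (3 * (ℓ : ℝ) + 1) * Real.log ((m : ℝ) + 1) ≤ (3 * ℓ + 1) * (2 * Λ) := by gcongr
  linarith

/-- The grid is fine enough that `2β / m ≤ 1 / (Mβc)`, which cancels the Lipschitz constant `≤ 5ℓβc`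
and leaves order `1 / M`. -/
theorem discretization_term_le {D V c β : ℝ} {M ℓ m : ℕ} (hM : 0 < M) (hV : 1 ≤ V)
    (hDV : D ≤ V) (hc : 1 ≤ c) (hβ : 1 ≤ β) (hℓ : 1 ≤ ℓ) (hm : m = ⌈2 * M * β ^ 2 * c⌉₊) :
    8 * D * ((1 + 4 * ℓ * β * c) * (2 * β / m)) ≤ V ^ 2 * (40 * ℓ) / √M := by
  have hM' : (1 : ℝ) ≤ M := by exact_mod_cast hM
  have hℓ' : (1 : ℝ) ≤ ℓ := by exact_mod_cast hℓ
  have hm1 : 2 * M * β ^ 2 * c ≤ m := hm ▸ Nat.le_ceil _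
  have hm0 : (0 : ℝ) < m := lt_of_lt_of_le (by positivity) hm1
  have h1 : 2 * β / m ≤ 1 / (M * β * c) := by
    rw [div_le_div_iff₀ hm0 (by positivity)]
    linarith
  have hβc : 1 ≤ β * c := one_le_mul_of_one_le_of_one_le hβ hc
  have h2 : 1 + 4 * ℓ * β * c ≤ 5 * ℓ * (β * c) := by
    linarith [one_le_mul_of_one_le_of_one_le hℓ' hβc]
  have h3 : √(M : ℝ) ≤ M := Real.sqrt_le_iff.2 ⟨by linarith, le_self_pow₀ hM' two_ne_zero⟩
  have h0 : 0 < √(M : ℝ) := Real.sqrt_pos.2 (by linarith)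
  calc _ ≤ 8 * V * ((5 * ℓ * (β * c)) * (1 / (M * β * c))) := by gcongr
    _ = V * (40 * ℓ) / M := by field_simp; ring
    _ ≤ V ^ 2 * (40 * ℓ) / √M := by
      gcongr
      exact le_self_pow₀ hV two_ne_zero

theorem deviation_term_le {D V B s : ℝ} (M : ℕ) (hD : 0 ≤ D) (hDV : D ≤ V)
    (hs : 3 ≤ s) (hB : B ≤ 6 * s) :
    2 * D ^ 2 / √(2 * M) * √B ≤ V ^ 2 * (2 * s) / √M := by
  -- Equivalent to `6s ≤ 2s²`, hence the assumption `3 ≤ s`.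
  have h2 : √(6 * s) ≤ √2 * s := by
    rw [Real.sqrt_le_iff]
    refine ⟨by positivity, ?_⟩
    rw [mul_pow, Real.sq_sqrt (by norm_num)]
    nlinarith
  have h4 : √(2 : ℝ) ≠ 0 := by positivity
  rw [Real.sqrt_mul (by norm_num)]
  calc _ ≤ 2 * V ^ 2 / (√2 * √M) * (√2 * s) := by
        gcongr
        exact (Real.sqrt_le_sqrt hB).trans h2
    _ = _ := by
      rw [div_mul_eq_mul_div, show 2 * V ^ 2 * (√2 * s) = √2 * (V ^ 2 * (2 * s)) by ring,
        mul_div_mul_left _ _ h4]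

theorem generalization_term_le {u v c β p : ℝ} {M ℓ n m : ℕ} (hM : 0 < M) (huv : u ≤ v)
    (hc : 1 ≤ c) (hβ : c ≤ β) (hℓ : 3 ≤ ℓ) (hnp : (n : ℝ) ≤ max (p / 2) 1)
    (hm : m = ⌈2 * M * β ^ 2 * c⌉₊) :
    √(2 * (v - u) ^ 2 / √(2 * M) * √(n + Real.log (2 * ((m : ℝ) + 1) ^ (3 * ℓ + 1)))
        + 8 * (v - u) * ((1 + 4 * ℓ * β * c) * (2 * β / m)))
      ≤ max (v - u) 1
            * (20 * ((ℓ : ℝ) + 1) ^ (3 / 2 : ℝ)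
                * max (p / 2) (Real.log (4 * (M : ℝ) * β * c))) ^ (1 / 2 : ℝ)
            / (M : ℝ) ^ (1 / 4 : ℝ) := by
  have hM' : (1 : ℝ) ≤ M := by exact_mod_cast hM
  have hℓ' : (3 : ℝ) ≤ ℓ := by exact_mod_cast hℓ
  have hβ1 : 1 ≤ β := hc.trans hβ
  set Λ := max (p / 2) (Real.log (4 * (M : ℝ) * β * c)) with hΛ
  set V := max (v - u) 1 with hV
  have hV1 : 1 ≤ V := le_max_right _ _
  have hVv : v - u ≤ V := le_max_left _ _
  have hΛlam : Real.log (4 * (M : ℝ) * β * c) ≤ Λ := le_max_right _ _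
  have hΛ1 : 1.38 ≤ Λ := by
    have hMβc : 1 ≤ M * β * c := one_le_mul_of_one_le_of_one_le
      (one_le_mul_of_one_le_of_one_le hM' hβ1) hc
    have h1 : Real.log 4 ≤ Real.log (4 * (M : ℝ) * β * c) :=
      Real.log_le_log (by norm_num) (by linarith)
    linarith [log_four_gt]
  have hnΛ : (n : ℝ) ≤ Λ := hnp.trans (max_le (le_max_left _ _) (by linarith))
  have hlog := log_grid_card_le (ℓ := ℓ) hM hc hβ1 hΛlam hΛ1 hm
  have hC₃ := discretization_term_le (ℓ := ℓ) hM hV1 hVv hc hβ1 (by omega) hm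
  have hs : 0 ≤ √(M : ℝ) := Real.sqrt_nonneg _
  have hℓΛ : 3 * 1.38 ≤ (ℓ : ℝ) * Λ := mul_le_mul hℓ' hΛ1 (by norm_num) (by linarith)
  have hℓΛ' : (ℓ : ℝ) * 1.38 ≤ ℓ * Λ := mul_le_mul_of_nonneg_left hΛ1 (by linarith)
  have hC₂ := deviation_term_le (s := ((ℓ : ℝ) + 1) * Λ) M (sub_nonneg.2 huv) hVv (by linarith)
    (show n + Real.log (2 * ((m : ℝ) + 1) ^ (3 * ℓ + 1)) ≤ 6 * (((ℓ : ℝ) + 1) * Λ) by linarith)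
  -- The power 3/2 absorbs a factor 2, since `√(ℓ + 1) ≥ 2` for `ℓ ≥ 3`.
  have hpow := two_mul_le_rpow_three_halves (show 4 ≤ (ℓ : ℝ) + 1 by linarith)
  have h1 : 2 * (((ℓ : ℝ) + 1) * Λ) + 40 * ℓ ≤ 20 * (2 * ((ℓ : ℝ) + 1)) * Λ := by linarith
  have h2 : 20 * (2 * ((ℓ : ℝ) + 1)) * Λ ≤ 20 * ((ℓ : ℝ) + 1) ^ (3 / 2 : ℝ) * Λ :=
    mul_le_mul_of_nonneg_right (by linarith) (by linarith)
  have hfin : V ^ 2 * (2 * (((ℓ : ℝ) + 1) * Λ)) / √M + V ^ 2 * (40 * ℓ) / √M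
      ≤ V ^ 2 * (20 * ((ℓ : ℝ) + 1) ^ (3 / 2 : ℝ) * Λ) / √M := by
    rw [← add_div, ← mul_add]
    exact div_le_div_of_nonneg_right (mul_le_mul_of_nonneg_left (h1.trans h2) (sq_nonneg V)) hs
  refine (Real.sqrt_le_sqrt ((add_le_add hC₂ hC₃).trans hfin)).trans_eq ?_
  have hM4 : √(√(M : ℝ)) = (M : ℝ) ^ (1 / 4 : ℝ) := by
    rw [Real.sqrt_eq_rpow, Real.sqrt_eq_rpow, ← Real.rpow_mul (by linarith)]
    norm_num
  rw [Real.sqrt_div' _ hs, Real.sqrt_mul (sq_nonneg V), Real.sqrt_sq (by linarith), hM4,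
    ← Real.sqrt_eq_rpow]

theorem simplified_bound {u v a b c β L p : ℝ} {M K ℓ : ℕ} (hM : 0 < M) (hK : 0 < K)
    (huv : u < v) (hab : a < b) (hc1 : 1 ≤ c) (hcu : 2 * |u| ≤ c) (hcv : 2 * |v| ≤ c)
    (hca : |a| ≤ c) (hcb : |b| ≤ c) (hcL : 2 * L ≤ c) (hβ : c ≤ β) (hℓ : 3 ≤ ℓ) :
    L * (b - a) / ((ℓ : ℝ) - 2)
        + (8 * (v - u) * ((ℓ : ℝ) + 1) ^ 2 * c ^ 3 * max (p / 2) 1) ^ (1 / 2 : ℝ)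
            / (K : ℝ) ^ (((ℓ : ℝ) + 1) ^ (-2 : ℤ) / 4)
        + max (v - u) 1
            * (20 * ((ℓ : ℝ) + 1) ^ (3 / 2 : ℝ)
                * max (p / 2) (Real.log (4 * (M : ℝ) * β * c))) ^ (1 / 2 : ℝ)
            / (M : ℝ) ^ (1 / 4 : ℝ)
      ≤ 3 * c ^ 2 / (ℓ : ℝ)
        + 4 * c ^ 2 * (ℓ : ℝ) * max p 1 / (K : ℝ) ^ (((ℓ : ℝ) + 1) ^ (-2 : ℤ) / 4)
        + 6 * β * c * (ℓ : ℝ) * max p (Real.log (Real.exp 1 * (M : ℝ)))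
            / (M : ℝ) ^ (1 / 4 : ℝ) := by
  have hM' : (1 : ℝ) ≤ M := by exact_mod_cast hM
  have hℓ' : (3 : ℝ) ≤ ℓ := by exact_mod_cast hℓ
  have hβ1 : 1 ≤ β := hc1.trans hβ
  have hvu : v - u ≤ c := by linarith [neg_abs_le u, le_abs_self v]
  have hvu0 : 0 < v - u := sub_pos.2 huv
  have hba : b - a ≤ 2 * c := by linarith [neg_abs_le a, le_abs_self b]
  refine add_le_add (add_le_add ?_ ?_) ?_
  · have h1 : L * (b - a) ≤ c ^ 2 := by
      calc L * (b - a) ≤ (c / 2) * (2 * c) := by gcongr; linarith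
        _ = c ^ 2 := by ring
    rw [div_le_div_iff₀ (by linarith) (by linarith)]
    have : 0 ≤ c ^ 2 := sq_nonneg c
    nlinarith
  · gcongr
    rw [← Real.sqrt_eq_rpow, Real.sqrt_le_iff]
    have hq1 : 1 ≤ max p 1 := le_max_right _ _
    have hq : max (p / 2) 1 ≤ (max p 1) ^ 2 := by
      have h1 : max (p / 2) 1 ≤ max p 1 :=
        max_le (by linarith [le_max_left p 1, le_max_right p 1]) (le_max_right _ _)
      nlinarith
    refine ⟨by positivity, ?_⟩
    have h1 : ((ℓ : ℝ) + 1) ^ 2 ≤ 2 * ℓ ^ 2 := by nlinarith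
    calc _ ≤ 8 * c * (2 * ℓ ^ 2) * c ^ 3 * (max p 1) ^ 2 := by gcongr
      _ = _ := by ring
  · refine div_le_div_of_nonneg_right ?_ (by positivity)
    set Q := max p (Real.log (Real.exp 1 * (M : ℝ))) with hQ
    have hlogM : Real.log (Real.exp 1 * (M : ℝ)) = 1 + Real.log M := by
      rw [Real.log_mul (Real.exp_pos 1).ne' (by linarith), Real.log_exp]
    have hlM : 0 ≤ Real.log M := Real.log_nonneg hM'
    have hQM : 1 + Real.log M ≤ Q := hlogM ▸ le_max_right _ _
    have hQ1 : 1 ≤ Q := by linarith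
    have hQp : p ≤ Q := le_max_left _ _
    have hβ2 : 1 ≤ β ^ 2 := by nlinarith
    -- From `c ≤ β` and `log (β²) ≤ β² - 1`; the constant is an upper bound for `log 4`.
    have hΛ : max (p / 2) (Real.log (4 * (M : ℝ) * β * c)) ≤ 1.39 * β ^ 2 * Q ^ 2 := by
      have hβQ : β ^ 2 * Q ≤ β ^ 2 * Q ^ 2 := by gcongr; nlinarith
      have hQβ : Q ≤ β ^ 2 * Q := le_mul_of_one_le_left (by linarith) hβ2
      refine max_le (by nlinarith) ?_
      have h1 : Real.log (4 * (M : ℝ) * β * c) ≤ Real.log 4 + Real.log M + Real.log (β ^ 2) := by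
        rw [← Real.log_mul (by norm_num) (by linarith), ← Real.log_mul (by positivity) (by positivity)]
        refine Real.log_le_log (by positivity) ?_
        rw [pow_two, ← mul_assoc]
        gcongr
      have h2 := Real.log_le_sub_one_of_pos (show 0 < β ^ 2 by positivity)
      have h3 := log_four_lt
      have h4 : Real.log M + β ^ 2 ≤ β ^ 2 * Q := by nlinarith
      nlinarith
    -- Equality holds at `ℓ = 3`; then `20 · 8/9 · 1.39 < 36 = 6²`.
    have hpow : ((ℓ : ℝ) + 1) ^ (3 / 2 : ℝ) ≤ 8 / 9 * ℓ ^ 2 := by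
      have e : ((ℓ : ℝ) + 1) ^ (3 / 2 : ℝ) = √(((ℓ : ℝ) + 1) ^ 3) := by
        rw [Real.sqrt_eq_rpow, ← Real.rpow_natCast, ← Real.rpow_mul (by positivity)]
        norm_num
      rw [e, Real.sqrt_le_iff]
      refine ⟨by positivity, ?_⟩
      have h1 : (ℓ : ℝ) + 1 ≤ 4 / 3 * ℓ := by linarith
      calc ((ℓ : ℝ) + 1) ^ 3 ≤ (4 / 3 * (ℓ : ℝ)) ^ 3 := by gcongr
        _ = 64 / 81 * (ℓ : ℝ) ^ 3 * 3 := by ring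
        _ ≤ 64 / 81 * (ℓ : ℝ) ^ 3 * ℓ := by gcongr
        _ = (8 / 9 * (ℓ : ℝ) ^ 2) ^ 2 := by ring
    have hV : max (v - u) 1 ≤ c := max_le hvu hc1
    have hΛ0 : 0 ≤ max (p / 2) (Real.log (4 * (M : ℝ) * β * c)) :=
      le_max_of_le_right (Real.log_nonneg (by
        have := one_le_mul_of_one_le_of_one_le
          (one_le_mul_of_one_le_of_one_le hM' hβ1) hc1
        linarith))
    have hsq : (20 * ((ℓ : ℝ) + 1) ^ (3 / 2 : ℝ)
        * max (p / 2) (Real.log (4 * (M : ℝ) * β * c))) ^ (1 / 2 : ℝ) ≤ 6 * β * ℓ * Q := by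
      rw [← Real.sqrt_eq_rpow, Real.sqrt_le_iff]
      refine ⟨by positivity, ?_⟩
      calc _ ≤ 20 * (8 / 9 * ℓ ^ 2) * (1.39 * β ^ 2 * Q ^ 2) := by gcongr
        _ = (20 * 8 / 9 * 1.39) * (ℓ ^ 2 * β ^ 2 * Q ^ 2) := by ring
        _ ≤ 36 * (ℓ ^ 2 * β ^ 2 * Q ^ 2) := by gcongr; norm_num
        _ = _ := by ring
    calc _ ≤ c * (6 * β * ℓ * Q) :=
          mul_le_mul hV hsq (Real.rpow_nonneg (by positivity) _) (by linarith)
      _ = _ := by ring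

/-! ### Extension of the target, measurability and assembly -/

theorem sqL2Error_congr_right (ν : Measure ℝ) {a b : ℝ} (f : ℝ → ℝ) {g g' : ℝ → ℝ}
    (h : ∀ x ∈ Set.Icc a b, g x = g' x) : sqL2Error ν a b f g = sqL2Error ν a b f g' :=
  setIntegral_congr_fun measurableSet_Icc fun x hx => by simp only [h x hx]

/-- Composing with the projection onto `[a, b]`, which is 1-Lipschitz, keeps `L` and the range and
makes the target measurable on all of `ℝ`. -/
theorem exists_continuous_extension {a b u v L : ℝ} (hab : a ≤ b) {E : ℝ → ℝ}
    (hE : Set.MapsTo E (Set.Icc a b) (Set.Icc u v)) (hL : 0 ≤ L)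
    (hELip : ∀ x ∈ Set.Icc a b, ∀ y ∈ Set.Icc a b, |E x - E y| ≤ L * |x - y|) :
    ∃ E' : ℝ → ℝ, Continuous E' ∧ (∀ x, E' x ∈ Set.Icc u v) ∧ (∀ x ∈ Set.Icc a b, E x = E' x) ∧
      ∀ x y, |E' x - E' y| ≤ L * |x - y| := by
  have hLip : ∀ x y, |E (Set.projIcc a b hab x) - E (Set.projIcc a b hab y)| ≤ L * |x - y| := by
    intro x y
    refine (hELip _ (Set.projIcc a b hab x).2 _ (Set.projIcc a b hab y).2).trans ?_
    exact mul_le_mul_of_nonneg_left (Set.abs_projIcc_sub_projIcc hab) hL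
  refine ⟨fun x => E (Set.projIcc a b hab x), ?_, fun x => hE (Set.projIcc a b hab x).2,
    fun x hx => ?_, hLip⟩
  · refine (LipschitzWith.of_dist_le_mul (K := L.toNNReal) fun x y => ?_).continuous
    simpa [Real.dist_eq, Real.coe_toNNReal _ hL] using hLip x y
  · simp only [Set.projIcc_of_mem hab hx]

/-- For `p > 4` take `⌈p / 4⌉ < p / 4 + 1 < p / 2`; otherwise 1 suffices. -/
theorem exists_nat_exponent (p : ℝ) :
    ∃ n : ℕ, 1 ≤ n ∧ p ≤ 4 * n ∧ (n : ℝ) ≤ max (p / 2) 1 := by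
  by_cases h : p ≤ 4
  · exact ⟨1, le_rfl, by simpa using h, by simp⟩
  · have h := not_le.1 h
    refine ⟨⌈p / 4⌉₊, Nat.one_le_iff_ne_zero.2 (Nat.ceil_pos.2 (by linarith)).ne', ?_, ?_⟩
    · linarith [Nat.le_ceil (p / 4)]
    · exact le_max_of_le_left (by linarith [Nat.ceil_lt_add_one (show 0 ≤ p / 4 by linarith)])

theorem measurable_sqL2Error_shallowNet {Ω : Type*} [MeasurableSpace Ω] {d : ℕ} (u v : ℝ) (ℓ : ℕ)
    (ν : Measure ℝ) [IsFiniteMeasure ν] (a b : ℝ) {E : ℝ → ℝ} (hE : Continuous E)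
    {Θ : Ω → (Fin d → ℝ)} (hΘ : Measurable Θ) :
    Measurable fun ω => sqL2Error ν a b (shallowNet u v (Θ ω) ℓ) E := by
  have h : Continuous fun q : (Fin d → ℝ) × ℝ => |shallowNet u v q.1 ℓ q.2 - E q.2| ^ 2 :=
    (((continuous_shallowNet u v ℓ).sub (hE.comp continuous_snd)).abs).pow 2
  have h2 : StronglyMeasurable fun θ : Fin d → ℝ => sqL2Error ν a b (shallowNet u v θ ℓ) E :=
    h.stronglyMeasurable.integral_prod_right (ν := ν.restrict (Set.Icc a b))
  exact h2.measurable.comp hΘ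

theorem mul_rpow_cancel {K x κ : ℝ} {m : ℕ} (hK : 0 < K) (hx : 0 ≤ x) (hm : m ≠ 0)
    (hκ : κ = 1 / (m : ℝ)) : K ^ (-κ) * (K * x ^ m) ^ κ = x := by
  have hm' : (m : ℝ) ≠ 0 := by exact_mod_cast hm
  rw [Real.mul_rpow hK.le (by positivity), ← mul_assoc, ← Real.rpow_add hK, neg_add_cancel,
    Real.rpow_zero, one_mul, ← Real.rpow_natCast, ← Real.rpow_mul hx, hκ,
    mul_one_div_cancel hm', Real.rpow_one]

theorem mainTheorem9
    (d M K N : ℕ) (hM : 0 < M) (hK : 0 < K) (hN : 0 < N)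
    (p L a b u v c β : ℝ) (hp : 0 < p) (hL : 0 ≤ L) (huv : u < v) (hab : a < b)
    (hc1 : 1 ≤ c) (hcu : 2 * |u| ≤ c) (hcv : 2 * |v| ≤ c) (hca : |a| ≤ c) (hcb : |b| ≤ c)
    (hcL : 2 * L ≤ c) (hβ : c ≤ β)
    (ℓ : ℕ) (hℓ : 3 ≤ ℓ) (hd : 3 * ℓ + 1 ≤ d)
    (S : Set ℕ) (hS : S ⊆ Set.Iic N) (hS0 : 0 ∈ S)
    {Ω : Type*} [MeasurableSpace Ω] (P : Measure Ω) [IsProbabilityMeasure P]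
    -- the i.i.d. training samples, indexed from 0
    (X Y : Fin M → Ω → ℝ)
    (hX : ∀ j, Measurable (X j)) (hY : ∀ j, Measurable (Y j))
    (hXmem : ∀ j ω, X j ω ∈ Set.Icc a b) (hYmem : ∀ j ω, Y j ω ∈ Set.Icc u v)
    (hindep : iIndepFun (fun j ω => (X j ω, Y j ω)) P)
    (hident : ∀ i j, IdentDistrib (fun ω => (X i ω, Y i ω)) (fun ω => (X j ω, Y j ω)) P P)
    -- the target function; only its values on `[a, b]` matter
    (E : ℝ → ℝ) (hE : Set.MapsTo E (Set.Icc a b) (Set.Icc u v))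
    (hEcond : (fun ω => E (X ⟨0, hM⟩ ω)) =ᵐ[P]
      P[Y ⟨0, hM⟩ | MeasurableSpace.comap (X ⟨0, hM⟩) inferInstance])
    (hELip : ∀ x ∈ Set.Icc a b, ∀ y ∈ Set.Icc a b, |E x - E y| ≤ L * |x - y|)
    -- the random parameter vectors and the selected index
    (Θ : ℕ → ℕ → Ω → (Fin d → ℝ)) (hΘ : ∀ k n, Measurable (Θ k n))
    (κ : Ω → ℕ × ℕ) (hκ : Measurable κ)
    (hΘindep : iIndepFun (fun (k : Set.Icc 1 K) => Θ k 0) P)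
    (hΘident : ∀ i ∈ Set.Icc 1 K, ∀ j ∈ Set.Icc 1 K, IdentDistrib (Θ i 0) (Θ j 0) P P)
    (hΘunif : pdf.IsUniform (Θ 1 0) (Set.Icc (fun _ => -c) (fun _ => c)) P volume)
    (R : (Fin d → ℝ) → Ω → ℝ)
    (hR : ∀ θ ω, R θ ω = 1 / (M : ℝ) * ∑ j, |shallowNet u v θ ℓ (X j ω) - Y j ω| ^ 2)
    (hκmem : ∀ ω, κ ω ∈ {q : ℕ × ℕ | q.1 ∈ Set.Icc 1 K ∧ q.2 ∈ S ∧ ‖Θ q.1 q.2 ω‖ ≤ β})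
    (hκmin : ∀ ω, IsMinOn (fun q : ℕ × ℕ => R (Θ q.1 q.2 ω) ω)
      {q : ℕ × ℕ | q.1 ∈ Set.Icc 1 K ∧ q.2 ∈ S ∧ ‖Θ q.1 q.2 ω‖ ≤ β} (κ ω)) :
    -- the integral and the expectation in the overall error are well defined
    (∀ ω, IntegrableOn (fun x => |shallowNet u v (Θ (κ ω).1 (κ ω).2 ω) ℓ x - E x| ^ 2)
      (Set.Icc a b) (P.map (X ⟨0, hM⟩))) ∧
    Measurable (fun ω => sqL2Error (P.map (X ⟨0, hM⟩)) a b
      (shallowNet u v (Θ (κ ω).1 (κ ω).2 ω) ℓ) E) ∧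
    Integrable (fun ω => (sqL2Error (P.map (X ⟨0, hM⟩)) a b
      (shallowNet u v (Θ (κ ω).1 (κ ω).2 ω) ℓ) E) ^ (p / 2)) P ∧
    -- the error estimate
    (∫ ω, (sqL2Error (P.map (X ⟨0, hM⟩)) a b
        (shallowNet u v (Θ (κ ω).1 (κ ω).2 ω) ℓ) E) ^ (p / 2) ∂P) ^ (1 / p)
      ≤ L * (b - a) / ((ℓ : ℝ) - 2)
        + (8 * (v - u) * ((ℓ : ℝ) + 1) ^ 2 * c ^ 3 * max (p / 2) 1) ^ (1 / 2 : ℝ)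
            / (K : ℝ) ^ (((ℓ : ℝ) + 1) ^ (-2 : ℤ) / 4)
        + max (v - u) 1
            * (20 * ((ℓ : ℝ) + 1) ^ (3 / 2 : ℝ)
                * max (p / 2) (Real.log (4 * (M : ℝ) * β * c))) ^ (1 / 2 : ℝ)
            / (M : ℝ) ^ (1 / 4 : ℝ) ∧
    -- the simplified estimate
    L * (b - a) / ((ℓ : ℝ) - 2)
        + (8 * (v - u) * ((ℓ : ℝ) + 1) ^ 2 * c ^ 3 * max (p / 2) 1) ^ (1 / 2 : ℝ)
            / (K : ℝ) ^ (((ℓ : ℝ) + 1) ^ (-2 : ℤ) / 4)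
        + max (v - u) 1
            * (20 * ((ℓ : ℝ) + 1) ^ (3 / 2 : ℝ)
                * max (p / 2) (Real.log (4 * (M : ℝ) * β * c))) ^ (1 / 2 : ℝ)
            / (M : ℝ) ^ (1 / 4 : ℝ)
      ≤ 3 * c ^ 2 / (ℓ : ℝ)
        + 4 * c ^ 2 * (ℓ : ℝ) * max p 1 / (K : ℝ) ^ (((ℓ : ℝ) + 1) ^ (-2 : ℤ) / 4)
        + 6 * β * c * (ℓ : ℝ) * max p (Real.log (Real.exp 1 * (M : ℝ)))
            / (M : ℝ) ^ (1 / 4 : ℝ) := by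
  obtain ⟨E', hE'c, hE'm, hEE', hE'L⟩ := exists_continuous_extension hab.le hE hL hELip
  simp only [sqL2Error_congr_right _ _ hEE']
  set X₀ := X ⟨0, hM⟩ with hX₀
  have hXm₀ : ∀ ω, X₀ ω ∈ Set.Icc a b := hXmem _
  have hcond : (fun ω => E' (X₀ ω)) =ᵐ[P] P[Y ⟨0, hM⟩ | MeasurableSpace.comap X₀ inferInstance] := by
    filter_upwards [hEcond] with ω h
    rw [← h, hEE' _ (hXm₀ ω)]
  have : IsProbabilityMeasure (P.map X₀) := Measure.isProbabilityMeasure_map (hX _).aemeasurable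
  set Φ : Ω → (Fin d → ℝ) := fun ω => Θ (κ ω).1 (κ ω).2 ω with hΦ
  have hΦm : Measurable Φ := by
    -- The index set is countable, so evaluation at a random index stays measurable.
    have h : Measurable fun q : (ℕ × ℕ) × Ω => Θ q.1.1 q.1.2 q.2 :=
      measurable_from_prod_countable_right fun q => hΘ q.1 q.2
    exact h.comp (hκ.prodMk measurable_id)
  have hnet : ∀ θ : Fin d → ℝ, Measurable (shallowNet u v θ ℓ) := fun θ =>
    ((continuous_shallowNet u v ℓ).comp (Continuous.prodMk_right θ)).measurable
  have hnetm : ∀ (θ : Fin d → ℝ) x, shallowNet u v θ ℓ x ∈ Set.Icc u v := fun θ x => by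
    rw [shallowNet_eq]; exact clipping_mem huv.le _
  set F : Ω → ℝ := fun ω => sqL2Error (P.map X₀) a b (shallowNet u v (Φ ω) ℓ) E' with hF
  have hFm : Measurable F := measurable_sqL2Error_shallowNet u v ℓ _ a b hE'c hΦm
  have hF0 : ∀ ω, 0 ≤ F ω := fun ω => integral_nonneg fun x => by positivity
  have hFD : ∀ ω, F ω ≤ (v - u) ^ 2 := by
    intro ω
    simp only [hF]
    rw [sqL2Error_map_eq (hX _) hXm₀ (hnet _) hE'c.measurable]
    refine (integral_mono (integrable_sq_abs_sub (u := u) (v := v) ((hnet _).comp (hX _))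
      (hE'c.measurable.comp (hX _)) (fun _ => hnetm _ _) fun _ => hE'm _)
      (integrable_const ((v - u) ^ 2)) fun ω' => ?_).trans_eq (by simp)
    exact (sq_abs_sub_mem_Icc (hnetm _ _) (hE'm _)).2
  refine ⟨fun ω => ?_, hFm, ?_, ?_,
    simplified_bound hM hK huv hab hc1 hcu hcv hca hcb hcL hβ hℓ⟩
  · have h : IntegrableOn (fun x => |shallowNet u v (Φ ω) ℓ x - E' x| ^ 2) (Set.Icc a b)
        (P.map X₀) :=
      (integrable_sq_abs_sub (hnet _) hE'c.measurable (hnetm _) hE'm).integrableOn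
    exact h.congr_fun (fun x hx => by simp only [hΦ, hEE' x hx]) measurableSet_Icc
  · refine Integrable.of_mem_Icc 0 (((v - u) ^ 2) ^ (p / 2)) (hFm.pow_const _).aemeasurable
      (Filter.Eventually.of_forall fun ω => ⟨Real.rpow_nonneg (hF0 ω) _, ?_⟩)
    exact Real.rpow_le_rpow (hF0 ω) (hFD ω) (by positivity)
  -- the error estimate
  have hM' : (1 : ℝ) ≤ M := by exact_mod_cast hM
  have hK' : (0 : ℝ) < K := by exact_mod_cast hK
  have hℓ' : (3 : ℝ) ≤ ℓ := by exact_mod_cast hℓ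
  have hc0 : 0 < c := by linarith
  have hvu : 0 < v - u := sub_pos.2 huv
  obtain ⟨n, hn1, hpn, hnp⟩ := exists_nat_exponent p
  have hEa : |E' a| ≤ c := by
    have h := hE'm a
    exact abs_le.2 ⟨by linarith [h.1, neg_abs_le u, abs_nonneg u],
      by linarith [h.2, le_abs_self v, abs_nonneg v]⟩
  obtain ⟨w₀, hw₀, happrox⟩ :=
    exists_shallowSum_approx hab hL hE'L (by omega : 0 < ℓ) hc1 hca hcb hcL hEa
  set m : ℕ := ⌈2 * M * β ^ 2 * c⌉₊ with hm
  have hm0 : 0 < m := Nat.ceil_pos.2 (by have := hc0.trans_le hβ; positivity)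
  obtain ⟨T, hTm, hTtail, hT⟩ := exists_tail_abs_empRisk_sub_trueRisk_le (P := P) hM ℓ huv hc1
    hca hcb (hc0.trans_le hβ) hm0 hX hY hXmem hYmem hindep hident
  set lg := Real.log (2 * ((m : ℝ) + 1) ^ (3 * ℓ + 1)) with hlg
  have hlg0 : 0 ≤ lg := by
    refine Real.log_nonneg ?_
    have : (1 : ℝ) ≤ ((m : ℝ) + 1) ^ (3 * ℓ + 1) := one_le_pow₀ (by simp)
    linarith
  set Z : Ω → ℝ := fun ω =>
    K * (bestDist hK (3 * ℓ) (fun k => Θ k 0) w₀ ω / (2 * c)) ^ (3 * ℓ + 1) with hZ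
  have hbest0 : ∀ ω, 0 ≤ bestDist hK (3 * ℓ) (fun k => Θ k 0) w₀ ω / (2 * c) := fun ω =>
    div_nonneg (bestDist_nonneg ..) (by positivity)
  have hZm : Measurable Z :=
    ((measurable_bestDist hK (3 * ℓ) (fun k => hΘ k 0) w₀).div_const _ |>.pow_const _).const_mul _
  have hZ0 : ∀ ω, 0 ≤ Z ω := fun ω => mul_nonneg hK'.le (pow_nonneg (hbest0 ω) _)
  have hZn : eLpNorm Z n P ≤ ENNReal.ofReal n := by
    have h := eLpNorm_le_of_exp_tail hZm (fun y hy => measure_bestDist_pow_gt_le hK hd hc0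
      (fun k => hΘ k 0) hΘindep hΘident hΘunif hw₀ hy) hn1
    simpa only [max_eq_left (hZ0 _), ENNReal.ofReal_natCast] using h
  have hWn : eLpNorm (fun ω => max (T ω) 0 + lg) n P ≤ ENNReal.ofReal (n + lg) := by
    refine (eLpNorm_add_le (hTm.max measurable_const).aestronglyMeasurable
      aestronglyMeasurable_const (by exact_mod_cast hn1)).trans ?_
    rw [ENNReal.ofReal_add (Nat.cast_nonneg n) hlg0, ENNReal.ofReal_natCast]
    refine add_le_add (eLpNorm_le_of_exp_tail hTm hTtail hn1) ?_
    rw [eLpNorm_const _ (by exact_mod_cast (by omega)) (IsProbabilityMeasure.ne_zero P),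
      measure_univ, ENNReal.one_rpow, mul_one, Real.enorm_of_nonneg hlg0]
  have hunif1 := fun k (hk : k ∈ Set.Icc 1 K) =>
    (hΘident 1 ⟨le_rfl, hK⟩ k hk).ae_snd (p := fun θ => ‖θ‖ ≤ c)
      (measurableSet_le measurable_norm measurable_const)
      (ae_mem_Icc_of_isUniform hc0 (hΘ 1 0) hΘunif)
  -- Almost surely every initialization satisfies the norm constraint `≤ β` and so competes in the
  -- minimization.
  have hbdd : ∀ᵐ ω ∂P, ∀ k ∈ Set.Icc 1 K, ‖Θ k 0 ω‖ ≤ c := by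
    rw [ae_all_iff]
    intro k
    by_cases hk : k ∈ Set.Icc 1 K
    · filter_upwards [hunif1 k hk] with ω h _ using h
    · exact Filter.Eventually.of_forall fun ω h => absurd h hk
  set ρ : ℝ := 1 / ((3 * ℓ + 1 : ℕ) : ℝ) with hρ
  have hρ0 : 0 < ρ := by positivity
  have hρ2 : ρ ≤ 1 / 2 := by
    rw [hρ]
    refine one_div_le_one_div_of_le (by norm_num) ?_
    push_cast
    linarith
  have hRemp : ∀ θ ω, R θ ω = empRisk u v ℓ X Y (paramEntry θ) ω := fun θ ω => by
    simp only [hR, empRisk, shallowNet_eq]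
  have hle : ∀ᵐ ω ∂P, F ω ≤ (L * (b - a) / ℓ) ^ 2
      + 2 * (v - u) * (1 + 4 * ℓ * c * c) * (2 * c) * (K : ℝ) ^ (-ρ) * Z ω ^ ρ
      + (2 * (v - u) ^ 2 / √(2 * M) * √(max (T ω) 0 + lg)
        + 8 * (v - u) * ((1 + 4 * ℓ * β * c) * (2 * β / m))) := by
    filter_upwards [hbdd] with ω hω
    -- The initialization nearest to `w₀` is the competitor `(k, 0)`, admissible because `0 ∈ S`.
    obtain ⟨k, hk, hkeq⟩ := Finset.exists_mem_eq_inf' (Finset.nonempty_Icc.2 hK)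
      fun k => paramDist (3 * ℓ) (paramEntry (Θ k 0 ω)) w₀
    have hk' : k ∈ Set.Icc 1 K := Finset.mem_Icc.1 hk
    have hmin : empRisk u v ℓ X Y (paramEntry (Φ ω)) ω
        ≤ empRisk u v ℓ X Y (paramEntry (Θ k 0 ω)) ω := by
      rw [← hRemp, ← hRemp]
      exact hκmin ω (show (k, 0) ∈ _ from ⟨hk', hS0, (hω k hk').trans hβ⟩)
    have h := sqL2Error_le_of_empRisk_le (P := P) hM huv.le hc1 hca hcb hβ hX hY hXmem hYmem
      hE'c.measurable hE'm hcond hw₀ happrox (hT ω)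
      (fun i _ => (abs_paramEntry_le (Φ ω) i).trans (hκmem ω).2.2)
      (fun i _ => (abs_paramEntry_le (Θ k 0 ω) i).trans (hω k hk'))
      (fun i hi => abs_sub_le_paramDist (n := 3 * ℓ) hi _ w₀) hmin
    have hFe : F ω = sqL2Error (P.map X₀) a b
        (fun x => clipping u v (shallowSum ℓ (paramEntry (Φ ω)) x)) E' := by
      simp only [hF]
      congr 1
      ext x
      exact shallowNet_eq ..
    -- Solving the definition of `Z` for the distance produces the factor `K ^ (-ρ)`.
    have hdist : paramDist (3 * ℓ) (paramEntry (Θ k 0 ω)) w₀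
        = 2 * c * ((K : ℝ) ^ (-ρ) * Z ω ^ ρ) := by
      rw [hZ, mul_rpow_cancel hK' (hbest0 ω) (Nat.succ_ne_zero _) hρ, mul_div_cancel₀ _ (by positivity)]
      exact hkeq.symm
    have hsq : √((max (T ω) 0 + lg) / (2 * M)) = √(max (T ω) 0 + lg) / √(2 * M) :=
      Real.sqrt_div' _ (by positivity)
    rw [hFe]
    refine h.trans_eq ?_
    rw [hdist, hsq]
    ring
  have hmain := integral_rpow_le_of_ae_le hFm hF0 hFD hZm hZ0
    ((hTm.max measurable_const).add_const lg)
    (fun ω => add_nonneg (le_max_right _ _) hlg0)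
    (div_nonneg (mul_nonneg hL (by linarith)) (Nat.cast_nonneg ℓ)) (by positivity) (by positivity)
    (by have := hc0.trans_le hβ; positivity) hρ0 hρ2 hp hn1 hpn (Nat.cast_nonneg n)
    (add_nonneg (Nat.cast_nonneg n) hlg0) hZn hWn hle
  refine hmain.trans (add_le_add (add_le_add ?_ ?_) ?_)
  · exact div_le_div_of_nonneg_left (mul_nonneg hL (by linarith)) (by linarith) (by linarith)
  · exact optimization_term_le hK huv.le hc1 hn1 hnp
  · exact generalization_term_le hM huv.le hc1 hβ hℓ hnp hm
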